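/- **Setting.** Let $n\ge 1$, $\hat n=\lceil\sqrt n\,\rceil$, $\hat k=\lceil n/\hat n\rceil$ and $\omega=e^{2\pi i/n!}$. A labeling is a bijection $x\mapsto\sigma_x$ from $\{0,\dots,n!-1\}$ onto the permutations of $\{0,\dots,n-1\}$. For $d$-dimensional unitaries $U_0,\dots,U_{n-1}$ put $\Pi_x=U_{\sigma_x(n-1)}\cdots U_{\sigma_x(1)}U_{\sigma_x(0)}$, $\Pi=U_{n-1}\cdots U_1U_0$ and $\Pi^r=U_0U_1\cdots U_{n-1}$. The Fourier promise problem (FPP) with this labeling is to find $y\in\{0,\dots,n!-1\}$, given query access to unitaries that satisfy the promise $\Pi_x=\omega^{xy}\,\Pi_0$ for all $x$. The unitaries satisfy pairwise commutation relations if for all $j,k$ there is $\alpha_{jk}\in\mathbb C$ with $U_jU_k=\alpha_{jk}U_kU_j$. For $0\le k\le\hat k-1$ let $\Pi_{xk}$ be the product, in this order, of the $U_{\sigma_x(j)}$ with $j\ge(k+1)\hat n$, arranged with descending indices; of the unchanged block $\cdots U_{\sigma_x(k\hat n+1)}U_{\sigma_x(k\hat n)}$ of positions $k\hat n\le j<\min((k+1)\hat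 n,n)$; and of the $U_{\sigma_x(j)}$ with $j<k\hat n$, arranged with descending indices. For $1\le k\le \hat k-1$ let $\tilde\Pi^r_{xk}$ be the product of the $U_{\sigma_x(j)}$ with $j<k\hat n$, arranged with ascending indices, followed on the right by the $U_{\sigma_x(j)}$ with $j\ge k\hat n$, arranged with ascending indices. **Circuits.** The systems are an $n!$-dimensional control system with basis $|x\rangle_c$, target systems $\Psi_k$ ($0\le k\le\hat k-1$) and $\Phi_k$ ($1\le k\le\hat k-1$), and auxiliary systems $a_i$ ($0\le i\le n-1$); all but the control system are $d$-dimensional. A causal circuit is a sequence of gates executed in a fixed order, each of them being a query (some $U_i$ is applied to some $d$-dimensional system), a controlled swap (two $d$-dimensional systems are swapped if the control is in a state $|x\rangle_c$ for which $\sigma_x$ has a given property), the Fourier transform $F_{n!}|y\rangle_c=\frac1{\sqrt{n!}}\sum_x\omega^{xy}|x\rangle_c$ of the control system, or its inverse. **Theorem.** For every $n\ge1$ there is a sequence $T$ of queries and controlled swaps, the same for all labelings, all $d$ and all unitaries, with the following properties. 1. Each $U_i$ is queried exactly $\hat n+4\hat k-4$ times in $T$. The circuit $A$ that consists of $F_{n!}$,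 then $T$, then $F_{n!}^{-1}$ uses exactly $Q=(\hat n+4\hat k-4)\,n$ queries, and $Q<(5\sqrt n+1)\,n$. 2. For every labeling, $A$ solves the corresponding FPP: if the unitaries, of any dimension $d$, satisfy the promise for $y$, the control system starts in $|0\rangle_c$ and the other systems start in arbitrary states $|\Psi_k\rangle,|\Phi_k\rangle,|a_i\rangle$, then a measurement of the control system in the computational basis after $A$ yields $y$ with probability $1$. 3. For every labeling, all $d$-dimensional unitaries $U_0,\dots,U_{n-1}$, all vectors $|\Psi_k\rangle,|\Phi_k\rangle,|a_i\rangle\in\mathbb C^d$ and all $x$, $$T\;|x\rangle_c\otimes\bigotimes_{k=0}^{\hat k-1}|\Psi_k\rangle\otimes\bigotimes_{k=1}^{\hat k-1}|\Phi_k\rangle\otimes\bigotimes_{i=0}^{n-1}|a_i\rangle=|x\rangle_c\otimes\bigotimes_{k=0}^{\hat k-1}\Pi_{xk}|\Psi_k\rangle\otimes\bigotimes_{k=1}^{\hat k-1}\tilde\Pi^r_{xk}|\Phi_k\rangle\otimes\bigotimes_{i=0}^{n-1}(U_i)^{\hat n+2\hat k-3}|a_i\rangle .$$ 4. If the unitaries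 satisfy pairwise commutation relations, or satisfy the promise for some $y$, the right-hand side in 3 equals $$|x\rangle_c\otimes\Pi_x|\Psi_0\rangle\otimes\bigotimes_{k=1}^{\hat k-1}\bigl(\Pi|\Psi_k\rangle\otimes\Pi^r|\Phi_k\rangle\bigr)\otimes\bigotimes_{i=0}^{n-1}(U_i)^{\hat n+2\hat k-3}|a_i\rangle ,$$ so every target and auxiliary system except $\Psi_0$ ends in a state that does not depend on $x$. 5. If the unitaries satisfy the promise for $y$, then $$A\;|0\rangle_c\otimes\bigotimes_{k=0}^{\hat k-1}|\Psi_k\rangle\otimes\bigotimes_{k=1}^{\hat k-1}|\Phi_k\rangle\otimes\bigotimes_{i=0}^{n-1}|a_i\rangle=|y\rangle_c\otimes\Pi_0|\Psi_0\rangle\otimes\bigotimes_{k=1}^{\hat k-1}\bigl(\Pi|\Psi_k\rangle\otimes\Pi^r|\Phi_k\rangle\bigr)\otimes\bigotimes_{i=0}^{n-1}(U_i)^{\hat n+2\hat k-3}|a_i\rangle .$$ -/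

import Mathlib

noncomputable section

namespace FPP

open Equiv

/-! ### Permutations, labelings and words in the black-box unitaries -/

/-- A labeling of the permutations of `{0, …, n-1}` by the numbers `x ∈ {0, …, n!-1}`:
`x ↦ σ_x`. -/
abbrev Labeling (n : ℕ) : Type := Fin n.factorial ≃ Perm (Fin n)

/-- The label `x = 0`. -/
def label0 (n : ℕ) : Fin n.factorial := ⟨0, n.factorial_pos⟩

/-- The product `U_{i₁} U_{i₂} ⋯ U_{i_r}` belonging to the string `[i₁, i₂, …, i_r]`, in the written
order (so that the last factor acts first). -/
def word {n d : ℕ} (U : Fin n → Matrix.unitaryGroup (Fin d) ℂ) (l : List (Fin n)) :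
    Matrix.unitaryGroup (Fin d) ℂ :=
  (l.map U).prod

/-- The string `π(n-1), …, π(1), π(0)`. -/
def permString {n : ℕ} (π : Perm (Fin n)) : List (Fin n) :=
  (List.ofFn π).reverse

/-- `Π_x = U_{σ_x(n-1)} ⋯ U_{σ_x(1)} U_{σ_x(0)}`, for `π = σ_x`. -/
def permProd {n d : ℕ} (U : Fin n → Matrix.unitaryGroup (Fin d) ℂ) (π : Perm (Fin n)) :
    Matrix.unitaryGroup (Fin d) ℂ :=
  word U (permString π)

/-- `Π = U_{n-1} ⋯ U_1 U_0`. -/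
def descProd {n d : ℕ} (U : Fin n → Matrix.unitaryGroup (Fin d) ℂ) :
    Matrix.unitaryGroup (Fin d) ℂ :=
  word U (List.finRange n).reverse

/-- `Π^r = U_0 U_1 ⋯ U_{n-1}`. -/
def ascProd {n d : ℕ} (U : Fin n → Matrix.unitaryGroup (Fin d) ℂ) :
    Matrix.unitaryGroup (Fin d) ℂ :=
  word U (List.finRange n)

/-- The root of unity `ω = e^{2πi/N}`. -/
def omega (N : ℕ) : ℂ := Complex.exp (2 * Real.pi * Complex.I / N)

/-- The promise of the Fourier promise problem with labeling `σ` and solution `y`: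
`Π_x = ω^{x y} Π_0` for all `x`, where `ω = e^{2πi/n!}`. -/
def Promise {n d : ℕ} (σ : Labeling n) (U : Fin n → Matrix.unitaryGroup (Fin d) ℂ)
    (y : Fin n.factorial) : Prop :=
  ∀ x : Fin n.factorial,
    (permProd U (σ x) : Matrix (Fin d) (Fin d) ℂ) =
      omega n.factorial ^ ((x : ℕ) * (y : ℕ)) •
        (permProd U (σ (label0 n)) : Matrix (Fin d) (Fin d) ℂ)

/-- Pairwise commutation relations: `U_j U_k = α_{jk} U_k U_j` with complex numbers `α_{jk}`. -/
def PairwiseCommutation {n d : ℕ} (U : Fin n → Matrix.unitaryGroup (Fin d) ℂ) : Prop :=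
  ∀ j k : Fin n, ∃ α : ℂ,
    (U j : Matrix (Fin d) (Fin d) ℂ) * (U k : Matrix (Fin d) (Fin d) ℂ) =
      α • ((U k : Matrix (Fin d) (Fin d) ℂ) * (U j : Matrix (Fin d) (Fin d) ℂ))

/-! ### Blocks -/

/-- The block length `⌈√n⌉`. -/
def blockLen (n : ℕ) : ℕ := ⌈Real.sqrt (n : ℝ)⌉₊

/-- The number of blocks `⌈n / ⌈√n⌉⌉`. -/
def numBlocks (n : ℕ) : ℕ := ⌈(n : ℝ) / (blockLen n : ℝ)⌉₊

/-- The indices `π(0), …, π(k m - 1)` of the first `k` blocks of length `m`. -/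
def lowerSet {n : ℕ} (m : ℕ) (π : Perm (Fin n)) (k : ℕ) : Finset (Fin n) :=
  (Finset.univ.filter fun j : Fin n => (j : ℕ) < k * m).image π

/-- The indices `π(k m), …, π(n-1)` of all later blocks. -/
def upperSet {n : ℕ} (m : ℕ) (π : Perm (Fin n)) (k : ℕ) : Finset (Fin n) :=
  (Finset.univ.filter fun j : Fin n => k * m ≤ (j : ℕ)).image π

/-- The string `π((k+1) m - 1), …, π(k m)` of the block with number `k` (positions `≥ n` are
skipped, so that the last block may be shorter). -/
def blockString {n : ℕ} (m : ℕ) (π : Perm (Fin n)) (k : ℕ) : List (Fin n) :=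
  (((List.finRange n).filter fun j : Fin n => k * m ≤ (j : ℕ) ∧ (j : ℕ) < (k + 1) * m).reverse).map π

/-- The string of `Π_{xk}`: the later blocks in descending order, then the unchanged block `k`, then
the earlier blocks in descending order. For the first block the last part is empty, for the last
block the first part is empty. -/
def psiString {n : ℕ} (m : ℕ) (π : Perm (Fin n)) (k : ℕ) : List (Fin n) :=
  (upperSet m π (k + 1)).sort (fun a b => a ≥ b) ++ blockString m π k ++
    (lowerSet m π k).sort (fun a b => a ≥ b)

/-- The string of `Π̃^r_{xk}`: the blocks before block `k` in ascending order, then all others in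
ascending order. -/
def phiString {n : ℕ} (m : ℕ) (π : Perm (Fin n)) (k : ℕ) : List (Fin n) :=
  (lowerSet m π k).sort (fun a b => a ≤ b) ++ (upperSet m π k).sort (fun a b => a ≤ b)

/-! ### Systems and states -/

/-- Indices of the target systems `Φ_k`, `1 ≤ k ≤ k̂ - 1`, with `k̂ = numBlocks n`. -/
abbrev PhiIndex (n : ℕ) : Type := {k : Fin (numBlocks n) // 1 ≤ (k : ℕ)}

/-- The `d`-dimensional systems: targets `Ψ_k` (`0 ≤ k ≤ k̂ - 1`), targets `Φ_k`
(`1 ≤ k ≤ k̂ - 1`) and auxiliary systems `a_i` (`0 ≤ i ≤ n - 1`). -/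
abbrev Wire (n : ℕ) : Type := Fin (numBlocks n) ⊕ PhiIndex n ⊕ Fin n

/-- Vectors of the tensor product of the control system `ℂ^{n!}` with one `ℂ^d` for every wire, by
their coordinates in the computational basis. -/
abbrev State (n d : ℕ) : Type := Fin n.factorial × (Wire n → Fin d) → ℂ

/-- The computational basis vector `|x⟩` of the control system. -/
def ket {n : ℕ} (x : Fin n.factorial) : Fin n.factorial → ℂ := Pi.single x 1

/-- The product state `χ ⊗ ⨂_k Ψ_k ⊗ ⨂_k Φ_k ⊗ ⨂_i a_i`. -/
def productState {n d : ℕ} (χ : Fin n.factorial → ℂ) (Ψ : Fin (numBlocks n) → Fin d → ℂ)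
    (Φ : PhiIndex n → Fin d → ℂ) (a : Fin n → Fin d → ℂ) : State n d :=
  fun p => χ p.1 * ((∏ k, Ψ k (p.2 (Sum.inl k))) * (∏ k, Φ k (p.2 (Sum.inr (Sum.inl k)))) *
    ∏ i, a i (p.2 (Sum.inr (Sum.inr i))))

/-- A vector of `ℂ^d` of Euclidean norm `1`. -/
def Normalized {d : ℕ} (v : Fin d → ℂ) : Prop := ∑ j, ‖v j‖ ^ 2 = 1

/-- The action of a unitary matrix on a vector. -/
def act {d : ℕ} (V : Matrix.unitaryGroup (Fin d) ℂ) (v : Fin d → ℂ) : Fin d → ℂ :=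
  (V : Matrix (Fin d) (Fin d) ℂ).mulVec v

/-- The probability of the outcome `y` when the control system is measured in the computational
basis. -/
def controlProb {n d : ℕ} (ψ : State n d) (y : Fin n.factorial) : ℝ :=
  ∑ b : Wire n → Fin d, ‖ψ (y, b)‖ ^ 2

/-! ### The Fourier transform -/

/-- The matrix of the Fourier transform, `F_N |y⟩ = N^{-1/2} ∑_x ω^{x y} |x⟩`. -/
def fourierMatrix (N : ℕ) : Matrix (Fin N) (Fin N) ℂ :=
  Matrix.of fun x y => ((Real.sqrt N : ℝ) : ℂ)⁻¹ * omega N ^ ((x : ℕ) * (y : ℕ))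

theorem fourierMatrix_mem (N : ℕ) : fourierMatrix N ∈ Matrix.unitaryGroup (Fin N) ℂ := by
  rcases Nat.eq_zero_or_pos N with rfl | hN
  · rw [Matrix.mem_unitaryGroup_iff']; ext i; exact i.elim0
  rw [Matrix.mem_unitaryGroup_iff']
  have hprim : IsPrimitiveRoot (omega N) N := Complex.isPrimitiveRoot_exp N hN.ne'
  have hne : omega N ≠ 0 := Complex.exp_ne_zero _
  have hconj : (starRingEnd ℂ) (omega N) = (omega N)⁻¹ := by
    rw [omega, ← Complex.exp_conj, ← Complex.exp_neg]
    congr 1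
    simp [neg_div, Complex.conj_ofNat]
  have hs : (((Real.sqrt N : ℝ) : ℂ)⁻¹) * (((Real.sqrt N : ℝ) : ℂ)⁻¹) = (N : ℂ)⁻¹ := by
    rw [← mul_inv, ← Complex.ofReal_mul, Real.mul_self_sqrt (Nat.cast_nonneg N)]
    simp
  ext y z
  have hterm : ∀ x : Fin N, star (fourierMatrix N) y x * fourierMatrix N x z =
      (N : ℂ)⁻¹ * (omega N ^ (z : ℕ) * (omega N ^ (y : ℕ))⁻¹) ^ (x : ℕ) := by
    intro x
    rw [Matrix.star_apply]
    simp only [fourierMatrix, Matrix.of_apply, star_mul', star_pow, Complex.star_def, map_inv₀,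
      Complex.conj_ofReal, hconj]
    rw [← hs]
    rw [mul_pow, inv_pow, inv_pow, ← pow_mul, ← pow_mul, mul_comm (z : ℕ), mul_comm (y : ℕ)]
    ring
  rw [Matrix.mul_apply, Finset.sum_congr rfl fun x _ => hterm x, ← Finset.mul_sum,
    Fin.sum_univ_eq_sum_range fun k => (omega N ^ (z : ℕ) * (omega N ^ (y : ℕ))⁻¹) ^ k]
  have hN0 : (N : ℂ) ≠ 0 := by exact_mod_cast hN.ne'
  by_cases h : y = z
  · subst h
    rw [mul_inv_cancel₀ (pow_ne_zero _ hne)]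
    simp [hN0]
  · rw [Matrix.one_apply_ne h]
    have hq : omega N ^ (z : ℕ) * (omega N ^ (y : ℕ))⁻¹ ≠ 1 := by
      intro hq
      apply h
      rw [mul_inv_eq_one₀ (pow_ne_zero _ hne)] at hq
      exact Fin.ext (hprim.pow_inj z.2 y.2 hq).symm
    rw [geom_sum_eq hq, mul_pow, inv_pow, ← pow_mul, ← pow_mul, mul_comm (z : ℕ), mul_comm (y : ℕ),
      pow_mul, pow_mul, hprim.pow_eq_one]
    simp

/-- The Fourier transform as a unitary. -/
def fourier (N : ℕ) : Matrix.unitaryGroup (Fin N) ℂ := ⟨fourierMatrix N, fourierMatrix_mem N⟩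

/-! ### Circuits -/

/-- The gates. Nothing in a gate refers to the black-box unitaries, to their dimension or to the
labeling; these enter only when the gate is executed.
* `query i w`: the black-box unitary `U_i` acts on the system `w` (one query, never controlled).
* `cswap P v w`: the systems `v` and `w` are swapped if the control system is in a state `|x⟩` whose
  permutation `σ_x` satisfies `P`.
* `fourier`, `fourierInv`: the Fourier transform of the control system and its inverse. -/
inductive Gate (n : ℕ) : Type
  | query (i : Fin n) (w : Wire n)
  | cswap (P : Perm (Fin n) → Bool) (v w : Wire n)
  | fourier
  | fourierInv

/-- A causal circuit: gates that are executed in a fixed order, the head of the list first. -/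
abbrev Circuit (n : ℕ) : Type := List (Gate n)

/-- A unitary acts on the system `w`. -/
def onWire {n d : ℕ} (V : Matrix.unitaryGroup (Fin d) ℂ) (w : Wire n) :
    State n d →ₗ[ℂ] State n d where
  toFun ψ p := ∑ j : Fin d, (V : Matrix (Fin d) (Fin d) ℂ) (p.2 w) j *
    ψ (p.1, Function.update p.2 w j)
  map_add' ψ φ := by
    funext p; simp [mul_add, Finset.sum_add_distrib]
  map_smul' c ψ := by
    funext p; simp [Finset.mul_sum, mul_left_comm]

/-- A unitary acts on the control system. -/
def onControl {n d : ℕ} (V : Matrix.unitaryGroup (Fin n.factorial) ℂ) :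
    State n d →ₗ[ℂ] State n d where
  toFun ψ p := ∑ x : Fin n.factorial,
    (V : Matrix (Fin n.factorial) (Fin n.factorial) ℂ) p.1 x * ψ (x, p.2)
  map_add' ψ φ := by
    funext p; simp [mul_add, Finset.sum_add_distrib]
  map_smul' c ψ := by
    funext p; simp [Finset.mul_sum, mul_left_comm]

/-- The systems `v` and `w` are swapped on those `|x⟩` for which `P x` holds. -/
def controlledSwap {n d : ℕ} (P : Fin n.factorial → Bool) (v w : Wire n) :
    State n d →ₗ[ℂ] State n d where
  toFun ψ p := ψ (p.1, if P p.1 then p.2 ∘ Equiv.swap v w else p.2)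
  map_add' _ _ := rfl
  map_smul' _ _ := rfl

/-- Execution of a gate, for a labeling `σ` and black-box unitaries `U`. -/
def runGate {n d : ℕ} (σ : Labeling n) (U : Fin n → Matrix.unitaryGroup (Fin d) ℂ) :
    Gate n → (State n d →ₗ[ℂ] State n d)
  | .query i w => onWire (U i) w
  | .cswap P v w => controlledSwap (fun x => P (σ x)) v w
  | .fourier => onControl (FPP.fourier n.factorial)
  | .fourierInv => onControl (FPP.fourier n.factorial)⁻¹

/-- Execution of a circuit. -/
def run {n d : ℕ} (σ : Labeling n) (U : Fin n → Matrix.unitaryGroup (Fin d) ℂ) :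
    Circuit n → (State n d →ₗ[ℂ] State n d)
  | [] => LinearMap.id
  | g :: C => run σ U C ∘ₗ runGate σ U g

/-- The number of queries to `U_i` in a gate. -/
def gateQueriesTo {n : ℕ} (i : Fin n) : Gate n → ℕ
  | .query j _ => if j = i then 1 else 0
  | _ => 0

/-- The number of queries to `U_i` in a circuit. -/
def queriesTo {n : ℕ} (i : Fin n) (C : Circuit n) : ℕ := (C.map (gateQueriesTo i)).sum

/-- The number of queries of a circuit. -/
def queries {n : ℕ} (C : Circuit n) : ℕ := ∑ i, queriesTo i C

/-- The circuit consists of queries and controlled swaps only. -/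
def FourierFree {n : ℕ} (C : Circuit n) : Prop := Gate.fourier ∉ C ∧ Gate.fourierInv ∉ C

/-- The circuit `C` between a Fourier transform of the control system and its inverse. -/
def fourierSandwich {n : ℕ} (C : Circuit n) : Circuit n :=
  Gate.fourier :: (C ++ [Gate.fourierInv])

/-- The circuit `C` solves the Fourier promise problem with labeling `σ`: for unitaries of any
dimension that satisfy the promise for `y`, when the control system is initialized in `|0⟩` and the
other systems in arbitrary states, a final measurement of the control system in the computational
basis gives `y` with certainty. -/
def Solves {n : ℕ} (C : Circuit n) (σ : Labeling n) : Prop :=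
  ∀ (d : ℕ) (U : Fin n → Matrix.unitaryGroup (Fin d) ℂ) (y : Fin n.factorial), Promise σ U y →
    ∀ (Ψ : Fin (numBlocks n) → Fin d → ℂ) (Φ : PhiIndex n → Fin d → ℂ) (a : Fin n → Fin d → ℂ),
      (∀ k, Normalized (Ψ k)) → (∀ k, Normalized (Φ k)) → (∀ i, Normalized (a i)) →
        controlProb (run σ U C (productState (ket (label0 n)) Ψ Φ a)) y = 1

/-- The final states of the targets `Ψ_k`: `V` is applied to `Ψ_0`, and `Π` to every other one. -/
def psiFinal {n d : ℕ} (U : Fin n → Matrix.unitaryGroup (Fin d) ℂ)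
    (V : Matrix.unitaryGroup (Fin d) ℂ) (Ψ : Fin (numBlocks n) → Fin d → ℂ) :
    Fin (numBlocks n) → Fin d → ℂ :=
  fun k => if (k : ℕ) = 0 then act V (Ψ k) else act (descProd U) (Ψ k)

/-- The final states of the targets `Φ_k`: `Π^r` is applied to every one. -/
def phiFinal {n d : ℕ} (U : Fin n → Matrix.unitaryGroup (Fin d) ℂ)
    (Φ : PhiIndex n → Fin d → ℂ) : PhiIndex n → Fin d → ℂ :=
  fun k => act (ascProd U) (Φ k)

/-- The final states of the auxiliary systems: `(U_i)^{k_i}` with `k_i = ⌈√n⌉ + 2 k̂ - 3` is applied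
to `a_i`. -/
def auxFinal {n d : ℕ} (U : Fin n → Matrix.unitaryGroup (Fin d) ℂ)
    (a : Fin n → Fin d → ℂ) : Fin n → Fin d → ℂ :=
  fun i => act (U i ^ (blockLen n + 2 * numBlocks n - 3)) (a i)

end FPP

end

/-! A query to `U i` made on `a_i` between two identical controlled swaps acts, in the branch `|x⟩`,
on whichever system the swaps select as a function of `σ x`, and leaves all others alone. So a
circuit amounts to a list of steps (an index `i` and a target depending on the permutation), and in
the branch `|x⟩` each system undergoes the product of the unitaries routed to it, its `trace`
(`run_compile`). What remains is to choose steps whose traces on the targets are the required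
strings, cheaply.

The saving comes from the unsorted blocks. Distinct blocks have distinct targets `Ψ_k`, so one pass
of `n` queries serves one position in every block, and `blockLen n` passes handle all blocks. The
sorted parts need no adaptation of the query order: a fixed pass in ascending or descending order
suffices, with unwanted unitaries diverted to `a_i`. There are four such passes for each `k ≥ 1`.
Each target receives every `U i` exactly once (`trace_psi`, `trace_phi`), so the exponent on `a_i`
is the total number of queries minus the number of targets (`trace_aux`).

If `U_i U_j = α_ij U_j U_i`, sorting a product multiplies it by one factor `α` per inverted pair
(`prod_eq_smul_of_pairwise`). For `i < j`, the string of `Ψ_k` has `i` left of `j` in two cases: `j`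
lies in block `k` and precedes `i` in `σ x`, or `j` lies before block `k` and `i` does not. The
second kind is exactly what `Φ_k` inverts, in the opposite direction, and `α_ij α_ji = 1` cancels it
(`psiPhase_mul_phiPhase`). Over all `k` the first kind exhausts the inversions of `Π_x`, so the
total phase is that of `Π_x` (`prod_psiPhase_mul_prod_phiPhase`). In a tensor product it may be
assigned to `Ψ_0` alone.

The promise implies pairwise commutation relations (`Promise.pairwiseCommutation`). The phase
`ω^{xy}` then passes to the control system, where the inverse Fourier transform turns it into `|y⟩`
(`run_fourierSandwich`). -/

noncomputable section

namespace FPP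

open Equiv

/-! ### Product states indexed by all systems -/

/-- The product state with the vector `v w` on the system `w`. -/
def prodState {n d : ℕ} (χ : Fin n.factorial → ℂ) (v : Wire n → Fin d → ℂ) : State n d :=
  fun p => χ p.1 * ∏ w, v w (p.2 w)

/-- The vectors on all systems, collected in one family. -/
def wires {n d : ℕ} (Ψ : Fin (numBlocks n) → Fin d → ℂ) (Φ : PhiIndex n → Fin d → ℂ)
    (a : Fin n → Fin d → ℂ) : Wire n → Fin d → ℂ :=
  Sum.elim Ψ (Sum.elim Φ a)

theorem productState_eq {n d : ℕ} (χ : Fin n.factorial → ℂ) (Ψ : Fin (numBlocks n) → Fin d → ℂ)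
    (Φ : PhiIndex n → Fin d → ℂ) (a : Fin n → Fin d → ℂ) :
    productState χ Ψ Φ a = prodState χ (wires Ψ Φ a) := by
  funext p
  simp [productState, prodState, wires, Fintype.prod_sum_type, mul_assoc]

theorem act_mul {d : ℕ} (V W : Matrix.unitaryGroup (Fin d) ℂ) (v : Fin d → ℂ) :
    act (V * W) v = act V (act W v) := by
  simp [act, Matrix.mulVec_mulVec]

theorem act_one {d : ℕ} (v : Fin d → ℂ) : act (1 : Matrix.unitaryGroup (Fin d) ℂ) v = v := by
  simp [act]

theorem onWire_prodState {n d : ℕ} (V : Matrix.unitaryGroup (Fin d) ℂ) (w : Wire n)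
    (χ : Fin n.factorial → ℂ) (v : Wire n → Fin d → ℂ) :
    onWire V w (prodState χ v) = prodState χ (Function.update v w (act V (v w))) := by
  funext p
  simp only [onWire, prodState, LinearMap.coe_mk, AddHom.coe_mk]
  rw [← Finset.mul_prod_erase _ _ (Finset.mem_univ w)]
  have h : ∀ j, ∏ u, v u (Function.update p.2 w j u) =
      v w j * ∏ u ∈ Finset.univ.erase w, v u (p.2 u) := by
    intro j
    rw [← Finset.mul_prod_erase _ _ (Finset.mem_univ w)]
    congr 1
    · simp
    · refine Finset.prod_congr rfl fun u hu => ?_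
      rw [Function.update_of_ne (Finset.ne_of_mem_erase hu)]
  have h' : ∏ u ∈ Finset.univ.erase w, Function.update v w (act V (v w)) u (p.2 u) =
      ∏ u ∈ Finset.univ.erase w, v u (p.2 u) := by
    refine Finset.prod_congr rfl fun u hu => ?_
    rw [Function.update_of_ne (Finset.ne_of_mem_erase hu)]
  rw [h', Function.update_self]
  simp only [h, act, Matrix.mulVec, dotProduct, Finset.sum_mul, Finset.mul_sum]
  exact Finset.sum_congr rfl fun j _ => by ring

theorem controlledSwap_prodState {n d : ℕ} (P : Fin n.factorial → Bool) (u w : Wire n)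
    (x : Fin n.factorial) (v : Wire n → Fin d → ℂ) :
    controlledSwap P u w (prodState (ket x) v) =
      prodState (ket x) (if P x then v ∘ swap u w else v) := by
  funext p
  simp only [controlledSwap, prodState, LinearMap.coe_mk, AddHom.coe_mk]
  by_cases hx : p.1 = x
  · rw [hx]
    congr 1
    split_ifs
    · rw [← Equiv.prod_comp (swap u w)]
      simp
    · rfl
  · simp [ket, hx]

/-! ### Programs: queries routed by the permutation -/

/-- A query whose target system depends on the permutation. -/
abbrev Step (n : ℕ) : Type := Fin n × (Perm (Fin n) → Wire n)

/-- The auxiliary system `a_i`. -/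
abbrev aux {n : ℕ} (i : Fin n) : Wire n := Sum.inr (Sum.inr i)

/-- The controlled swaps that bring the target of a step to the auxiliary system. -/
def routing {n : ℕ} (s : Step n) (l : List (Wire n)) : Circuit n :=
  l.map fun w => Gate.cswap (fun π => decide (s.2 π = w)) w (aux s.1)

/-- The circuit of a step. -/
def stepCircuit {n : ℕ} (s : Step n) : Circuit n :=
  routing s Finset.univ.toList ++ Gate.query s.1 (aux s.1) :: routing s Finset.univ.toList

/-- The circuit of a list of steps. -/
def compile {n : ℕ} (prog : List (Step n)) : Circuit n := prog.flatMap stepCircuit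

/-- The unitaries that act on the system `w`, in temporal order. -/
def trace {n : ℕ} (π : Perm (Fin n)) (w : Wire n) (prog : List (Step n)) : List (Fin n) :=
  (prog.filter fun s => s.2 π = w).map Prod.fst

theorem run_append {n d : ℕ} (σ : Labeling n) (U : Fin n → Matrix.unitaryGroup (Fin d) ℂ)
    (C D : Circuit n) (ψ : State n d) : run σ U (C ++ D) ψ = run σ U D (run σ U C ψ) := by
  induction C generalizing ψ with
  | nil => rfl
  | cons g C ih => exact ih _

-- Only the swap for `w = s.2 (σ x)` fires. Without repetitions in `l` it fires at most once; a
-- second firing would undo it.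
open scoped Classical in
theorem run_routing {n d : ℕ} (σ : Labeling n) (U : Fin n → Matrix.unitaryGroup (Fin d) ℂ)
    (s : Step n) (x : Fin n.factorial) (l : List (Wire n)) (hl : l.Nodup)
    (v : Wire n → Fin d → ℂ) :
    run σ U (routing s l) (prodState (ket x) v) =
      prodState (ket x) (if s.2 (σ x) ∈ l then v ∘ swap (s.2 (σ x)) (aux s.1) else v) := by
  induction l generalizing v with
  | nil => simp [routing, run]
  | cons w l ih =>
    rw [List.nodup_cons] at hl
    change run σ U (routing s l) (controlledSwap _ _ _ _) = _
    rw [controlledSwap_prodState, ih hl.2]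
    by_cases h : s.2 (σ x) = w
    · subst h
      simp [hl.1]
    · simp [h]

/-- Conjugating the query by the swap moves its action from `aux s.1` to the chosen system; if that
system is `aux s.1` itself, the swap is trivial. -/
theorem run_stepCircuit {n d : ℕ} (σ : Labeling n) (U : Fin n → Matrix.unitaryGroup (Fin d) ℂ)
    (s : Step n) (x : Fin n.factorial) (v : Wire n → Fin d → ℂ) :
    run σ U (stepCircuit s) (prodState (ket x) v) =
      prodState (ket x) (Function.update v (s.2 (σ x)) (act (U s.1) (v (s.2 (σ x))))) := by
  rw [stepCircuit, run_append, run_routing _ _ _ _ _ (Finset.nodup_toList _)]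
  change run σ U (routing s _) (onWire _ _ _) = _
  rw [onWire_prodState, run_routing _ _ _ _ _ (Finset.nodup_toList _)]
  simp only [Finset.mem_toList, Finset.mem_univ, if_true]
  congr 1
  funext w
  simp only [Function.comp_apply, swap_apply_right]
  by_cases h : w = s.2 (σ x)
  · subst h
    simp
  · rw [Function.update_of_ne h, Function.update_of_ne]
    · simp
    · intro h'
      apply h
      rw [← swap_apply_right (s.2 (σ x)) (aux s.1)] at h'
      exact (swap (s.2 (σ x)) (aux s.1)).injective (by simpa using h')

/-- The reversal converts temporal order into the written order of a product, whose last factor acts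
first. -/
theorem run_compile {n d : ℕ} (σ : Labeling n) (U : Fin n → Matrix.unitaryGroup (Fin d) ℂ)
    (x : Fin n.factorial) (prog : List (Step n)) (v : Wire n → Fin d → ℂ) :
    run σ U (compile prog) (prodState (ket x) v) =
      prodState (ket x) fun w => act (word U (trace (σ x) w prog).reverse) (v w) := by
  induction prog generalizing v with
  | nil => simp [compile, run, trace, word, act_one]
  | cons s prog ih =>
    rw [compile, List.flatMap_cons, run_append, run_stepCircuit]
    change run σ U (compile prog) _ = _
    rw [ih]
    congr 1
    funext w
    by_cases h : s.2 (σ x) = w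
    · subst h
      simp [trace, word, act_mul]
    · rw [Function.update_of_ne (Ne.symm h)]
      simp [trace, h]

/-! ### Counting queries and composing traces -/

theorem queriesTo_append {n : ℕ} (i : Fin n) (C D : Circuit n) :
    queriesTo i (C ++ D) = queriesTo i C + queriesTo i D := by
  simp [queriesTo]

theorem queriesTo_routing {n : ℕ} (i : Fin n) (s : Step n) (l : List (Wire n)) :
    queriesTo i (routing s l) = 0 := by
  simp [queriesTo, routing, Function.comp_def, gateQueriesTo]

theorem queriesTo_compile {n : ℕ} (i : Fin n) (prog : List (Step n)) :
    queriesTo i (compile prog) = (prog.map Prod.fst).count i := by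
  induction prog with
  | nil => simp [compile, queriesTo]
  | cons s prog ih =>
    rw [compile, List.flatMap_cons, queriesTo_append]
    change _ + queriesTo i (compile prog) = _
    rw [ih, stepCircuit, queriesTo_append, queriesTo_routing]
    change 0 + (gateQueriesTo i _ + queriesTo i (routing s _)) + _ = _
    rw [queriesTo_routing, List.map_cons, List.count_cons]
    simp [gateQueriesTo, add_comm]

theorem fourierFree_compile {n : ℕ} (prog : List (Step n)) : FourierFree (compile prog) := by
  simp [FourierFree, compile, stepCircuit, routing]

/-- For fixed `π` each step has exactly one target, so the traces partition the queries. This later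
gives the exponents on the auxiliary systems by subtraction. -/
theorem sum_count_trace {n : ℕ} (π : Perm (Fin n)) (i : Fin n) (prog : List (Step n)) :
    ∑ w, (trace π w prog).count i = (prog.map Prod.fst).count i := by
  induction prog with
  | nil => simp [trace]
  | cons s prog ih =>
    have h : ∀ w, (trace π w (s :: prog)).count i =
        (trace π w prog).count i + if s.2 π = w then (if s.1 = i then 1 else 0) else 0 := by
      intro w
      by_cases hw : s.2 π = w <;> simp [trace, hw, List.count_cons]
    simp only [h, Finset.sum_add_distrib, ih, List.map_cons, List.count_cons]
    simp

theorem trace_append {n : ℕ} (π : Perm (Fin n)) (w : Wire n) (p q : List (Step n)) :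
    trace π w (p ++ q) = trace π w p ++ trace π w q := by
  simp [trace]

theorem trace_flatMap {n : ℕ} {ι : Type*} (π : Perm (Fin n)) (w : Wire n) (l : List ι)
    (f : ι → List (Step n)) :
    trace π w (l.flatMap f) = l.flatMap fun t => trace π w (f t) := by
  induction l with
  | nil => rfl
  | cons t l ih => simp [trace_append, ih]

/-! ### Block length and number of blocks -/

theorem blockLen_pos {n : ℕ} (hn : 1 ≤ n) : 0 < blockLen n := by
  rw [blockLen, Nat.ceil_pos]
  exact Real.sqrt_pos.2 (by exact_mod_cast hn)

theorem numBlocks_pos {n : ℕ} (hn : 1 ≤ n) : 0 < numBlocks n := by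
  have := blockLen_pos hn
  rw [numBlocks, Nat.ceil_pos]
  positivity

theorem le_numBlocks_mul {n : ℕ} (hn : 1 ≤ n) : n ≤ numBlocks n * blockLen n := by
  have hm : (0 : ℝ) < blockLen n := by exact_mod_cast blockLen_pos hn
  have h : (n : ℝ) / blockLen n ≤ numBlocks n := Nat.le_ceil _
  rw [div_le_iff₀ hm] at h
  exact_mod_cast h

theorem blockLen_add_numBlocks_lt {n : ℕ} (hn : 1 ≤ n) :
    (blockLen n : ℝ) + 4 * numBlocks n - 4 < 5 * Real.sqrt n + 1 := by
  have hs : 0 < Real.sqrt n := Real.sqrt_pos.2 (by exact_mod_cast hn)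
  have h1 : (blockLen n : ℝ) < Real.sqrt n + 1 := Nat.ceil_lt_add_one hs.le
  have h2 : Real.sqrt n ≤ blockLen n := Nat.le_ceil _
  have h3 : (numBlocks n : ℝ) < n / blockLen n + 1 := Nat.ceil_lt_add_one (by positivity)
  have h4 : (n : ℝ) / blockLen n ≤ Real.sqrt n := by
    rw [div_le_iff₀ (hs.trans_le h2)]
    calc (n : ℝ) = Real.sqrt n * Real.sqrt n := (Real.mul_self_sqrt (Nat.cast_nonneg n)).symm
      _ ≤ _ := by gcongr
  linarith

/-! ### The strings of the targets -/

theorem mem_lowerSet {n m k : ℕ} {π : Perm (Fin n)} {i : Fin n} :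
    i ∈ lowerSet m π k ↔ (π.symm i : ℕ) < k * m := by
  simp only [lowerSet, Finset.mem_image, Finset.mem_filter, Finset.mem_univ, true_and]
  exact ⟨by rintro ⟨j, hj, rfl⟩; simpa using hj, fun h => ⟨_, h, by simp⟩⟩

theorem mem_upperSet {n m k : ℕ} {π : Perm (Fin n)} {i : Fin n} :
    i ∈ upperSet m π k ↔ k * m ≤ (π.symm i : ℕ) := by
  simp only [upperSet, Finset.mem_image, Finset.mem_filter, Finset.mem_univ, true_and]
  exact ⟨by rintro ⟨j, hj, rfl⟩; simpa using hj, fun h => ⟨_, h, by simp⟩⟩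

theorem mem_blockString {n m k : ℕ} {π : Perm (Fin n)} {i : Fin n} :
    i ∈ blockString m π k ↔ k * m ≤ (π.symm i : ℕ) ∧ (π.symm i : ℕ) < (k + 1) * m := by
  simp only [blockString, List.mem_map, List.mem_reverse, List.mem_filter, List.mem_finRange,
    true_and, decide_eq_true_eq]
  exact ⟨by rintro ⟨j, hj, rfl⟩; simpa using hj, fun h => ⟨_, h, by simp⟩⟩

theorem pairwise_blockString {n : ℕ} (m : ℕ) (π : Perm (Fin n)) (k : ℕ) :
    (blockString m π k).Pairwise fun i j => π.symm j < π.symm i := by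
  rw [blockString, List.pairwise_map, List.pairwise_reverse]
  simp only [symm_apply_apply]
  exact (List.pairwise_lt_finRange n).filter _

theorem sort_le_eq_filter {n : ℕ} (S : Finset (Fin n)) (p : Fin n → Prop) [DecidablePred p]
    (h : ∀ i, i ∈ S ↔ p i) :
    S.sort (fun a b => a ≤ b) = (List.finRange n).filter fun i => p i := by
  refine List.Perm.eq_of_pairwise (le := fun a b => a ≤ b) (fun a b _ _ h h' => le_antisymm h h')
    (Finset.pairwise_sort _ _)
    (((List.pairwise_lt_finRange n).imp fun h => le_of_lt h).filter _) ?_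
  rw [List.perm_ext_iff_of_nodup (Finset.sort_nodup _ _) ((List.nodup_finRange n).filter _)]
  simp [h]

theorem sort_ge_eq_filter {n : ℕ} (S : Finset (Fin n)) (p : Fin n → Prop) [DecidablePred p]
    (h : ∀ i, i ∈ S ↔ p i) :
    S.sort (fun a b => a ≥ b) = ((List.finRange n).filter fun i => p i).reverse := by
  refine List.Perm.eq_of_pairwise (le := fun a b => a ≥ b) (fun a b _ _ h h' => le_antisymm h' h)
    (Finset.pairwise_sort _ _)
    (List.pairwise_reverse.2 (((List.pairwise_lt_finRange n).imp fun h => le_of_lt h).filter _)) ?_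
  rw [List.perm_ext_iff_of_nodup (Finset.sort_nodup _ _)
    (List.nodup_reverse.2 ((List.nodup_finRange n).filter _))]
  simp [h]

theorem reverse_psiString {n : ℕ} (m : ℕ) (π : Perm (Fin n)) (k : ℕ) :
    (psiString m π k).reverse =
      (List.finRange n).filter (fun i => (π.symm i : ℕ) < k * m) ++ (blockString m π k).reverse ++
        (List.finRange n).filter (fun i => (k + 1) * m ≤ (π.symm i : ℕ)) := by
  rw [psiString, sort_ge_eq_filter _ _ fun i => mem_upperSet,
    sort_ge_eq_filter _ _ fun i => mem_lowerSet]
  simp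

theorem reverse_phiString {n : ℕ} (m : ℕ) (π : Perm (Fin n)) (k : ℕ) :
    (phiString m π k).reverse =
      (List.finRange n).reverse.filter (fun i => k * m ≤ (π.symm i : ℕ)) ++
        (List.finRange n).reverse.filter (fun i => (π.symm i : ℕ) < k * m) := by
  rw [phiString, sort_le_eq_filter _ _ fun i => mem_upperSet,
    sort_le_eq_filter _ _ fun i => mem_lowerSet]
  simp

/-- `i` stands to the left of `j` in the string of `Π_{xk}`. -/
def PsiBefore {n : ℕ} (m : ℕ) (π : Perm (Fin n)) (k : ℕ) (i j : Fin n) : Prop :=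
  ((k + 1) * m ≤ (π.symm i : ℕ) ∧ (π.symm j : ℕ) < (k + 1) * m) ∨
  (k * m ≤ (π.symm i : ℕ) ∧ (π.symm j : ℕ) < k * m) ∨
  ((k + 1) * m ≤ (π.symm i : ℕ) ∧ (k + 1) * m ≤ (π.symm j : ℕ) ∧ j < i) ∨
  ((π.symm i : ℕ) < k * m ∧ (π.symm j : ℕ) < k * m ∧ j < i) ∨
  (k * m ≤ (π.symm i : ℕ) ∧ (π.symm i : ℕ) < (k + 1) * m ∧
    k * m ≤ (π.symm j : ℕ) ∧ (π.symm j : ℕ) < (k + 1) * m ∧ (π.symm j : ℕ) < π.symm i)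

/-- `i` stands to the left of `j` in the string of `Π̃^r_{xk}`. -/
def PhiBefore {n : ℕ} (m : ℕ) (π : Perm (Fin n)) (k : ℕ) (i j : Fin n) : Prop :=
  ((π.symm i : ℕ) < k * m ∧ k * m ≤ (π.symm j : ℕ)) ∨
  ((π.symm i : ℕ) < k * m ∧ (π.symm j : ℕ) < k * m ∧ i < j) ∨
  (k * m ≤ (π.symm i : ℕ) ∧ k * m ≤ (π.symm j : ℕ) ∧ i < j)

theorem PsiBefore.asymm {n m k : ℕ} {π : Perm (Fin n)} {i j : Fin n}
    (h : PsiBefore m π k i j) : ¬ PsiBefore m π k j i := by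
  -- `omega` treats both products as unrelated atoms, so the order of the block boundaries must be
  -- supplied.
  have : k * m ≤ (k + 1) * m := Nat.mul_le_mul_right _ (Nat.le_succ _)
  simp only [PsiBefore, Fin.lt_def] at h ⊢
  omega

theorem PhiBefore.asymm {n m k : ℕ} {π : Perm (Fin n)} {i j : Fin n}
    (h : PhiBefore m π k i j) : ¬ PhiBefore m π k j i := by
  simp only [PhiBefore, Fin.lt_def] at h ⊢
  omega

theorem pairwise_psiString {n : ℕ} (m : ℕ) (π : Perm (Fin n)) (k : ℕ) :
    (psiString m π k).Pairwise (PsiBefore m π k) := by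
  have hk : k * m ≤ (k + 1) * m := Nat.mul_le_mul_right _ (Nat.le_succ _)
  rw [psiString, List.pairwise_append, List.pairwise_append]
  refine ⟨⟨?_, ?_, ?_⟩, ?_, ?_⟩
  · refine (Finset.sortedGT_sort _).pairwise.imp_of_mem fun {i j} hi hj h => ?_
    rw [Finset.mem_sort, mem_upperSet] at hi hj
    exact Or.inr (Or.inr (Or.inl ⟨hi, hj, h⟩))
  · refine (pairwise_blockString m π k).imp_of_mem fun {i j} hi hj h => ?_
    rw [mem_blockString] at hi hj
    exact Or.inr (Or.inr (Or.inr (Or.inr ⟨hi.1, hi.2, hj.1, hj.2, h⟩)))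
  · intro i hi j hj
    rw [Finset.mem_sort, mem_upperSet] at hi
    rw [mem_blockString] at hj
    exact Or.inl ⟨hi, hj.2⟩
  · refine (Finset.sortedGT_sort _).pairwise.imp_of_mem fun {i j} hi hj h => ?_
    rw [Finset.mem_sort, mem_lowerSet] at hi hj
    exact Or.inr (Or.inr (Or.inr (Or.inl ⟨hi, hj, h⟩)))
  · intro i hi j hj
    rw [List.mem_append, Finset.mem_sort, mem_upperSet, mem_blockString] at hi
    rw [Finset.mem_sort, mem_lowerSet] at hj
    exact Or.inr (Or.inl ⟨by omega, hj⟩)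

theorem pairwise_phiString {n : ℕ} (m : ℕ) (π : Perm (Fin n)) (k : ℕ) :
    (phiString m π k).Pairwise (PhiBefore m π k) := by
  rw [phiString, List.pairwise_append]
  refine ⟨?_, ?_, ?_⟩
  · refine (Finset.sortedLT_sort _).pairwise.imp_of_mem fun {i j} hi hj h => ?_
    rw [Finset.mem_sort, mem_lowerSet] at hi hj
    exact Or.inr (Or.inl ⟨hi, hj, h⟩)
  · refine (Finset.sortedLT_sort _).pairwise.imp_of_mem fun {i j} hi hj h => ?_
    rw [Finset.mem_sort, mem_upperSet] at hi hj
    exact Or.inr (Or.inr ⟨hi, hj, h⟩)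
  · intro i hi j hj
    rw [Finset.mem_sort, mem_lowerSet] at hi
    rw [Finset.mem_sort, mem_upperSet] at hj
    exact Or.inl ⟨hi, hj⟩

theorem nodup_of_pairwise_asymm {α : Type*} {B : α → α → Prop} (hB : ∀ a b, B a b → ¬ B b a)
    {l : List α} (h : l.Pairwise B) : l.Nodup :=
  h.imp fun {a b} hab => by rintro rfl; exact hB _ _ hab hab

theorem mem_psiString {n : ℕ} (m : ℕ) (π : Perm (Fin n)) (k : ℕ) (i : Fin n) :
    i ∈ psiString m π k := by
  simp only [psiString, List.mem_append, Finset.mem_sort, mem_upperSet, mem_lowerSet,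
    mem_blockString]
  omega

theorem mem_phiString {n : ℕ} (m : ℕ) (π : Perm (Fin n)) (k : ℕ) (i : Fin n) :
    i ∈ phiString m π k := by
  simp only [phiString, List.mem_append, Finset.mem_sort, mem_upperSet, mem_lowerSet]
  omega

theorem count_psiString {n : ℕ} (m : ℕ) (π : Perm (Fin n)) (k : ℕ) (i : Fin n) :
    (psiString m π k).count i = 1 :=
  List.count_eq_one_of_mem
    (nodup_of_pairwise_asymm (fun _ _ => PsiBefore.asymm) (pairwise_psiString m π k))
    (mem_psiString m π k i)

theorem count_phiString {n : ℕ} (m : ℕ) (π : Perm (Fin n)) (k : ℕ) (i : Fin n) :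
    (phiString m π k).count i = 1 :=
  List.count_eq_one_of_mem
    (nodup_of_pairwise_asymm (fun _ _ => PhiBefore.asymm) (pairwise_phiString m π k))
    (mem_phiString m π k i)

/-! ### The program -/

/-- One query to each of the unitaries listed in `l`, with targets given by `g`. -/
def pass {n : ℕ} (l : List (Fin n)) (g : Fin n → Perm (Fin n) → Wire n) : List (Step n) :=
  l.map fun i => (i, g i)

/-- The unitaries of the first `k` blocks act on `w`. -/
def lowTarget {n : ℕ} (k : ℕ) (w : Wire n) (i : Fin n) (π : Perm (Fin n)) : Wire n :=
  if (π.symm i : ℕ) < k * blockLen n then w else aux i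

/-- The unitaries of the blocks from number `k` on act on `w`. -/
def highTarget {n : ℕ} (k : ℕ) (w : Wire n) (i : Fin n) (π : Perm (Fin n)) : Wire n :=
  if k * blockLen n ≤ (π.symm i : ℕ) then w else aux i

/-- In every block, the unitary at position `j` of the block acts on the target of the block. -/
def blockTarget {n : ℕ} (j : ℕ) (i : Fin n) (π : Perm (Fin n)) : Wire n :=
  -- The test always succeeds; it only provides the bound on the block number.
  if h : (π.symm i : ℕ) / blockLen n < numBlocks n then
    if (π.symm i : ℕ) % blockLen n = j then Sum.inl ⟨_, h⟩ else aux i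
  else aux i

/-- The target `Φ_k`. -/
abbrev phi {n : ℕ} (k : PhiIndex n) : Wire n := Sum.inr (Sum.inl k)

/-- The target `Ψ_{k-1}`. -/
def prevPsi {n : ℕ} (k : PhiIndex n) : Wire n :=
  Sum.inl ⟨k.1 - 1, lt_of_le_of_lt (Nat.sub_le _ _) k.1.2⟩

/-- All `k` with `1 ≤ k ≤ k̂ - 1`. -/
def phiIndices (n : ℕ) : List (PhiIndex n) := Finset.univ.toList

/-- The steps of the circuit. -/
def program (n : ℕ) : List (Step n) :=
  -- Ascending in time is descending in the written product.
  ((phiIndices n).flatMap fun k => pass (List.finRange n) (lowTarget k.1 (Sum.inl k.1))) ++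
  -- One pass per position within a block, shared by all blocks.
  ((List.range (blockLen n)).flatMap fun j => pass (List.finRange n) (blockTarget j)) ++
  -- Index shift: the blocks from `k` on are those after block `k - 1`.
  ((phiIndices n).flatMap fun k => pass (List.finRange n) (highTarget k.1 (prevPsi k))) ++
  -- For `Φ_k` the later blocks act first, since they stand on the right.
  ((phiIndices n).flatMap fun k => pass (List.finRange n).reverse (highTarget k.1 (phi k))) ++
  ((phiIndices n).flatMap fun k => pass (List.finRange n).reverse (lowTarget k.1 (phi k)))

theorem trace_pass {n : ℕ} (π : Perm (Fin n)) (w : Wire n) (l : List (Fin n))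
    (g : Fin n → Perm (Fin n) → Wire n) :
    trace π w (pass l g) = l.filter fun i => g i π = w := by
  simp [trace, pass, List.filter_map, Function.comp_def]

theorem trace_program {n : ℕ} (π : Perm (Fin n)) (w : Wire n) :
    trace π w (program n) =
      ((phiIndices n).flatMap fun k =>
        (List.finRange n).filter fun i => lowTarget k.1 (Sum.inl k.1) i π = w) ++
      ((List.range (blockLen n)).flatMap fun j =>
        (List.finRange n).filter fun i => blockTarget j i π = w) ++
      ((phiIndices n).flatMap fun k =>
        (List.finRange n).filter fun i => highTarget k.1 (prevPsi k) i π = w) ++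
      ((phiIndices n).flatMap fun k =>
        (List.finRange n).reverse.filter fun i => highTarget k.1 (phi k) i π = w) ++
      ((phiIndices n).flatMap fun k =>
        (List.finRange n).reverse.filter fun i => lowTarget k.1 (phi k) i π = w) := by
  simp only [program, trace_append, trace_flatMap, trace_pass]

theorem flatMap_eq_of_forall_ne {α β : Type*} {l : List α} (hl : l.Nodup) {a : α} (ha : a ∈ l)
    (f : α → List β) (h : ∀ b, b ≠ a → f b = []) : l.flatMap f = f a := by
  obtain ⟨s, t, rfl⟩ := List.append_of_mem ha
  rw [List.nodup_middle, List.nodup_cons, List.mem_append] at hl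
  have hs : s.flatMap f = [] :=
    List.flatMap_eq_nil_iff.2 fun b hb => h b fun e => hl.1 (Or.inl (e ▸ hb))
  have ht : t.flatMap f = [] :=
    List.flatMap_eq_nil_iff.2 fun b hb => h b fun e => hl.1 (Or.inr (e ▸ hb))
  simp [hs, ht]

theorem flatMap_phiIndices {n : ℕ} {β : Type*} (k : PhiIndex n) (f : PhiIndex n → List β)
    (h : ∀ b, b ≠ k → f b = []) : (phiIndices n).flatMap f = f k :=
  flatMap_eq_of_forall_ne (Finset.nodup_toList _) (by simp) f h

theorem flatMap_low {n : ℕ} (π : Perm (Fin n)) (k : Fin (numBlocks n)) :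
    ((phiIndices n).flatMap fun t =>
      (List.finRange n).filter fun i => lowTarget t.1 (Sum.inl t.1) i π = Sum.inl k) =
      (List.finRange n).filter fun i => (π.symm i : ℕ) < k * blockLen n := by
  by_cases hk : 1 ≤ (k : ℕ)
  · rw [flatMap_phiIndices ⟨k, hk⟩]
    · refine List.filter_congr fun i _ => ?_
      simp [lowTarget]
    · intro t ht
      refine List.filter_eq_nil_iff.2 fun i _ => ?_
      have : t.1 ≠ k := fun h => ht (Subtype.ext h)
      simp only [lowTarget]
      split_ifs <;> simp [this]
  -- No pass addresses `Ψ_0` here, and no block precedes block `0`.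
  · have hk0 : (k : ℕ) = 0 := by omega
    rw [List.filter_eq_nil_iff.2 (by simp [hk0]), List.flatMap_eq_nil_iff]
    intro t _
    refine List.filter_eq_nil_iff.2 fun i _ => ?_
    have : t.1 ≠ k := fun h => hk (h ▸ t.2)
    simp only [lowTarget]
    split_ifs <;> simp [this]

theorem flatMap_high {n : ℕ} (hn : 1 ≤ n) (π : Perm (Fin n)) (k : Fin (numBlocks n)) :
    ((phiIndices n).flatMap fun t =>
      (List.finRange n).filter fun i => highTarget t.1 (prevPsi t) i π = Sum.inl k) =
      (List.finRange n).filter fun i => ((k : ℕ) + 1) * blockLen n ≤ (π.symm i : ℕ) := by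
  by_cases hk : (k : ℕ) + 1 < numBlocks n
  · rw [flatMap_phiIndices ⟨⟨k + 1, hk⟩, by simp⟩]
    · refine List.filter_congr fun i _ => ?_
      simp [highTarget, prevPsi]
    · intro t ht
      refine List.filter_eq_nil_iff.2 fun i _ => ?_
      have : prevPsi t ≠ Sum.inl k := by
        intro h
        have h := congrArg Fin.val (Sum.inl_injective h)
        have := t.2
        exact ht (Subtype.ext (Fin.ext (by simp only at h ⊢; omega)))
      simp only [highTarget]
      split_ifs <;> simp [this]
  -- The last target gets no such pass; none is needed because the `numBlocks n` blocks already
  -- cover all positions.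
  · have hk0 : (k : ℕ) + 1 = numBlocks n := by omega
    have hlt : ∀ i : Fin n, (π.symm i : ℕ) < ((k : ℕ) + 1) * blockLen n := fun i => by
      rw [hk0]
      exact lt_of_lt_of_le (π.symm i).2 (le_numBlocks_mul hn)
    rw [List.filter_eq_nil_iff.2 fun i _ => by simpa using hlt i, List.flatMap_eq_nil_iff]
    intro t _
    refine List.filter_eq_nil_iff.2 fun i _ => ?_
    have : prevPsi t ≠ Sum.inl k := by
      intro h
      have h := congrArg Fin.val (Sum.inl_injective h)
      have h1 := t.2
      have h2 := t.1.2
      simp only at h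
      omega
    simp only [highTarget]
    split_ifs <;> simp [this]

theorem blockTarget_eq_inl {n j : ℕ} {i : Fin n} {π : Perm (Fin n)} {k : Fin (numBlocks n)} :
    blockTarget j i π = Sum.inl k ↔
      (π.symm i : ℕ) / blockLen n = k ∧ (π.symm i : ℕ) % blockLen n = j := by
  have := k.2
  simp only [blockTarget]
  split_ifs with h1 h2
  · simp [h2, Fin.ext_iff]
  · simp [h2]
  · simp only [false_iff]
    rintro ⟨h, -⟩
    omega

/-- Both lists increase strictly in the position `π.symm` and have the same members, hence coincide.
Quotient and remainder by `blockLen n` determine a position, so pass `j` contributes at most one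
entry. -/
theorem flatMap_block {n : ℕ} (hn : 1 ≤ n) (π : Perm (Fin n)) (k : Fin (numBlocks n)) :
    ((List.range (blockLen n)).flatMap fun j =>
      (List.finRange n).filter fun i => blockTarget j i π = Sum.inl k) =
      (blockString (blockLen n) π k).reverse := by
  have hm := blockLen_pos hn
  have hp : ((List.range (blockLen n)).flatMap fun j =>
      (List.finRange n).filter fun i => blockTarget j i π = Sum.inl k).Pairwise
      fun a b => π.symm a < π.symm b := by
    rw [List.pairwise_flatMap]
    constructor
    · intro j _
      refine List.Pairwise.imp_of_mem (R := fun a b => a ≠ b) ?_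
        ((List.nodup_finRange n).filter _)
      intro a b ha hb hab
      simp only [List.mem_filter, decide_eq_true_eq, blockTarget_eq_inl] at ha hb
      refine absurd (π.symm.injective (Fin.ext ?_)) hab
      rw [← Nat.div_add_mod (π.symm a : ℕ) (blockLen n), ha.2.1, ha.2.2,
        ← hb.2.1, ← hb.2.2, Nat.div_add_mod]
    · refine List.pairwise_lt_range.imp fun {j j'} hj a ha b hb => ?_
      simp only [List.mem_filter, decide_eq_true_eq, blockTarget_eq_inl] at ha hb
      rw [Fin.lt_def, ← Nat.div_add_mod (π.symm a : ℕ) (blockLen n),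
        ← Nat.div_add_mod (π.symm b : ℕ) (blockLen n), ha.2.1, ha.2.2, hb.2.1, hb.2.2]
      omega
  have hq : (blockString (blockLen n) π k).reverse.Pairwise fun a b => π.symm a < π.symm b :=
    List.pairwise_reverse.2 (pairwise_blockString _ π k)
  have hlt : ∀ a b : Fin n, π.symm a < π.symm b → ¬ π.symm b < π.symm a := fun _ _ h => h.asymm
  refine List.Perm.eq_of_pairwise (fun a b _ _ h h' => absurd h' (hlt a b h)) hp hq ?_
  rw [List.perm_ext_iff_of_nodup (nodup_of_pairwise_asymm hlt hp) (nodup_of_pairwise_asymm hlt hq)]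
  intro i
  simp only [List.mem_flatMap, List.mem_range, List.mem_filter, List.mem_finRange, true_and,
    decide_eq_true_eq, blockTarget_eq_inl, List.mem_reverse, mem_blockString]
  have hdiv : (k : ℕ) * blockLen n ≤ (π.symm i : ℕ) ∧
      (π.symm i : ℕ) < ((k : ℕ) + 1) * blockLen n ↔ (π.symm i : ℕ) / blockLen n = k := by
    rw [Nat.div_eq_iff hm, add_mul, one_mul]
    omega
  rw [hdiv]
  exact ⟨fun ⟨_, _, h, _⟩ => h, fun h => ⟨_, Nat.mod_lt _ hm, h, rfl⟩⟩

theorem trace_psi {n : ℕ} (hn : 1 ≤ n) (π : Perm (Fin n)) (k : Fin (numBlocks n)) :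
    trace π (Sum.inl k) (program n) = (psiString (blockLen n) π k).reverse := by
  rw [trace_program, flatMap_low, flatMap_block hn, flatMap_high hn, reverse_psiString]
  have h1 : ∀ t i, highTarget t.1 (phi t) i π ≠ Sum.inl k := fun t i => by
    simp only [highTarget]; split_ifs <;> simp
  have h2 : ∀ t i, lowTarget t.1 (phi t) i π ≠ Sum.inl k := fun t i => by
    simp only [lowTarget]; split_ifs <;> simp
  simp [h1, h2]

theorem trace_phi {n : ℕ} (π : Perm (Fin n)) (k : PhiIndex n) :
    trace π (phi k) (program n) = (phiString (blockLen n) π k.1).reverse := by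
  have h1 : ∀ (t : PhiIndex n) i, lowTarget t.1 (Sum.inl t.1) i π ≠ phi k := fun t i => by
    simp only [lowTarget]; split_ifs <;> simp
  have h2 : ∀ j i, blockTarget j i π ≠ phi k := fun j i => by
    simp only [blockTarget]; split_ifs <;> simp
  have h3 : ∀ (t : PhiIndex n) i, highTarget t.1 (prevPsi t) i π ≠ phi k := fun t i => by
    simp only [highTarget, prevPsi]; split_ifs <;> simp
  have h4 : ∀ t : PhiIndex n, t ≠ k → ∀ i, highTarget t.1 (phi t) i π ≠ phi k := fun t ht i => by
    simp only [highTarget]; split_ifs <;> simp [ht]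
  have h5 : ∀ t : PhiIndex n, t ≠ k → ∀ i, lowTarget t.1 (phi t) i π ≠ phi k := fun t ht i => by
    simp only [lowTarget]; split_ifs <;> simp [ht]
  have e4 : ((phiIndices n).flatMap fun t =>
      (List.finRange n).reverse.filter fun i => highTarget t.1 (phi t) i π = phi k) =
      (List.finRange n).reverse.filter fun i => k.1 * blockLen n ≤ (π.symm i : ℕ) := by
    rw [flatMap_phiIndices k _ fun t ht => by simp [h4 t ht]]
    exact List.filter_congr fun i _ => by simp [highTarget]
  have e5 : ((phiIndices n).flatMap fun t =>
      (List.finRange n).reverse.filter fun i => lowTarget t.1 (phi t) i π = phi k) =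
      (List.finRange n).reverse.filter fun i => (π.symm i : ℕ) < k.1 * blockLen n := by
    rw [flatMap_phiIndices k _ fun t ht => by simp [h5 t ht]]
    exact List.filter_congr fun i _ => by simp [lowTarget]
  rw [trace_program, reverse_phiString, e4, e5]
  simp only [h1, h2, h3, decide_false, List.filter_false]
  rw [List.flatMap_eq_nil_iff.2 fun _ _ => rfl, List.flatMap_eq_nil_iff.2 fun _ _ => rfl]
  simp

theorem mem_trace_aux {n : ℕ} (π : Perm (Fin n)) {i j : Fin n}
    (h : j ∈ trace π (aux i) (program n)) : j = i := by
  rw [trace_program] at h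
  simp only [List.mem_append, List.mem_flatMap, List.mem_filter, decide_eq_true_eq] at h
  rcases h with (((⟨t, _, _, h⟩ | ⟨t, _, _, h⟩) | ⟨t, _, _, h⟩) | ⟨t, _, _, h⟩) | ⟨t, _, _, h⟩
  all_goals
    simp only [lowTarget, highTarget, blockTarget, prevPsi] at h
    split_ifs at h <;> simp at h <;> exact h

theorem count_map_fst_program {n : ℕ} (i : Fin n) :
    ((program n).map Prod.fst).count i =
      blockLen n + 4 * (phiIndices n).length := by
  have h : ∀ (l : List (Fin n)) g, (pass l g).map Prod.fst = l := fun l g => by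
    simp [pass, Function.comp_def]
  have h1 : ∀ {ι : Type} (L : List ι) (l : List (Fin n)) (g : ι → Fin n → Perm (Fin n) → Wire n),
      l.count i = 1 → ((L.flatMap fun k => pass l (g k)).map Prod.fst).count i = L.length := by
    intro ι L l g hl
    induction L with
    | nil => simp
    | cons t L ih => rw [List.flatMap_cons, List.map_append, List.count_append, ih, h, hl,
        List.length_cons, add_comm]
  have h2 : (List.finRange n).count i = 1 :=
    List.count_eq_one_of_mem (List.nodup_finRange n) (List.mem_finRange i)
  have h3 : (List.finRange n).reverse.count i = 1 := by rw [List.count_reverse, h2]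
  simp only [program, List.map_append, List.count_append]
  rw [h1 _ _ _ h2, h1 _ _ _ h2, h1 _ _ _ h2, h1 _ _ _ h3, h1 _ _ _ h3, List.length_range]
  ring

theorem card_phiIndex (n : ℕ) : Fintype.card (PhiIndex n) = numBlocks n - 1 := by
  have h : ∀ N : ℕ, Fintype.card {k : Fin N // 1 ≤ (k : ℕ)} = N - 1 := by
    rintro (_ | N)
    · simp
    · have : (Finset.univ.filter fun k : Fin (N + 1) => 1 ≤ (k : ℕ)) = Finset.univ.erase 0 := by
        ext k
        rw [Finset.mem_filter, Finset.mem_erase, Nat.one_le_iff_ne_zero, Ne, Ne, Fin.ext_iff]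
        exact and_comm
      rw [Fintype.card_subtype, this, Finset.card_erase_of_mem (Finset.mem_univ _)]
      simp
  exact h _

/-- Only `i` can occur here, so a count suffices: of the `blockLen n + 4 (numBlocks n - 1)` queries
to `U i`, each of the `2 numBlocks n - 1` targets takes one. -/
theorem trace_aux {n : ℕ} (hn : 1 ≤ n) (π : Perm (Fin n)) (i : Fin n) :
    trace π (aux i) (program n) = List.replicate (blockLen n + 2 * numBlocks n - 3) i := by
  rw [List.eq_replicate_iff]
  refine ⟨?_, fun j hj => mem_trace_aux π hj⟩
  have hl : (trace π (aux i) (program n)).length = (trace π (aux i) (program n)).count i := by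
    rw [eq_comm, List.count_eq_length]
    exact fun j hj => (mem_trace_aux π hj).symm
  have hs := sum_count_trace π i (program n)
  rw [Fintype.sum_sum_type, Fintype.sum_sum_type] at hs
  have h0 : ∑ j, (trace π (aux j) (program n)).count i =
      (trace π (aux i) (program n)).count i := by
    refine Finset.sum_eq_single i (fun j _ hj => ?_) (by simp)
    exact List.count_eq_zero.2 fun h => hj (mem_trace_aux π h).symm
  rw [h0, count_map_fst_program] at hs
  have h1 : ∑ k, (trace π (Sum.inl k) (program n)).count i = numBlocks n := by
    rw [Finset.sum_congr rfl fun k _ => by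
      rw [trace_psi hn, List.count_reverse, count_psiString]]
    simp
  have h2 : ∑ k, (trace π (phi k) (program n)).count i = numBlocks n - 1 := by
    rw [Finset.sum_congr rfl fun k _ => by
      rw [trace_phi, List.count_reverse, count_phiString], ← card_phiIndex, Finset.sum_const,
      smul_eq_mul, mul_one, Finset.card_univ]
  have h3 : (phiIndices n).length = numBlocks n - 1 := by
    rw [phiIndices, Finset.length_toList, Finset.card_univ, card_phiIndex]
  rw [h1, h2, h3] at hs
  -- With at least one block, `hs` also forces `blockLen n + 2 * numBlocks n ≥ 3`, so the truncated
  -- subtraction is exact.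
  have := numBlocks_pos hn
  omega

/-! ### Reordering products of elements that commute up to scalars -/

section Reorder

variable {A ι : Type*} [Ring A] [Algebra ℂ A] {u : ι → A} {α : ι → ι → ℂ}

/-- The factor `u a` moves right past every `b` that does not satisfy `r a b`. Once it stops,
sortedness and transitivity make all remaining factors of the scalar equal to `1`. -/
theorem prod_orderedInsert (hu : ∀ i j, u i * u j = α i j • (u j * u i)) (r : ι → ι → Prop)
    [DecidableRel r] (a : ι) (l : List ι) (htrans : ∀ a b c, r a b → r b c → r a c)
    (hl : l.Pairwise r) :
    u a * (l.map u).prod =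
      (l.map fun b => if r a b then 1 else α a b).prod • ((l.orderedInsert r a).map u).prod := by
  induction l with
  | nil => simp
  | cons b l ih =>
    rw [List.pairwise_cons] at hl
    by_cases hab : r a b
    · have h1 : ((b :: l).map fun b => if r a b then 1 else α a b).prod = 1 := by
        refine List.prod_eq_one fun c hc => ?_
        rw [List.mem_map] at hc
        obtain ⟨e, he, rfl⟩ := hc
        rw [List.mem_cons] at he
        rcases he with rfl | he
        · rw [if_pos hab]
        · rw [if_pos (htrans _ _ _ hab (hl.1 e he))]
      rw [List.orderedInsert_cons, if_pos hab, h1, one_smul]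
      simp
    · rw [List.orderedInsert_cons, if_neg hab]
      simp only [List.map_cons, List.prod_cons, if_neg hab]
      rw [← mul_assoc, hu, smul_mul_assoc, mul_assoc, ih hl.2, mul_smul_comm, smul_smul]

/-- The scalar picked up when the product over a list is sorted. -/
def phase (α : ι → ι → ℂ) (r : ι → ι → Prop) [DecidableRel r] : List ι → ℂ
  | [] => 1
  | a :: l => (l.map fun b => if r a b then 1 else α a b).prod * phase α r l

theorem prod_eq_phase_smul (hu : ∀ i j, u i * u j = α i j • (u j * u i)) (r : ι → ι → Prop)
    [DecidableRel r] [Std.Total r] [IsTrans ι r] (l : List ι) :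
    (l.map u).prod = phase α r l • ((l.insertionSort r).map u).prod := by
  induction l with
  | nil => simp [phase]
  | cons a l ih =>
    rw [List.map_cons, List.prod_cons, ih, mul_smul_comm,
      prod_orderedInsert hu r a _ (fun a b c => _root_.trans) (List.pairwise_insertionSort r l),
      smul_smul, List.insertionSort_cons, phase, mul_comm,
      ((List.perm_insertionSort r l).map _).prod_eq]

/-- The recursive scalar becomes a product over ordered pairs that sees the string only through `B`.
Phases of different strings can then be compared pair by pair. -/
theorem phase_eq_prod [DecidableEq ι] (α : ι → ι → ℂ) (r B : ι → ι → Prop) [DecidableRel r]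
    [DecidableRel B] (hr : ∀ i, r i i) (hB : ∀ i j, B i j → ¬ B j i) (l : List ι)
    (hl : l.Pairwise B) :
    phase α r l =
      ∏ i ∈ l.toFinset, ∏ j ∈ l.toFinset, if B i j ∧ ¬ r i j then α i j else 1 := by
  induction l with
  | nil => simp [phase]
  | cons a l ih =>
    have hnd := nodup_of_pairwise_asymm hB hl
    rw [List.pairwise_cons] at hl
    rw [List.nodup_cons] at hnd
    have ha : a ∉ l.toFinset := by simpa using hnd.1
    rw [phase, ih hl.2, List.toFinset_cons, Finset.prod_insert ha, Finset.prod_insert ha]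
    congr 1
    · rw [if_neg (by simp [hr]), one_mul, List.prod_toFinset _ hnd.2]
      refine congrArg _ (List.map_congr_left fun b hb => ?_)
      by_cases h : r a b <;> simp [h, hl.1 b hb]
    · refine Finset.prod_congr rfl fun i hi => ?_
      rw [Finset.prod_insert ha, if_neg, one_mul]
      exact fun h => hB _ _ h.1 (hl.1 i (by simpa using hi))

end Reorder

theorem prod_eq_smul_of_pairwise {A : Type*} [Ring A] [Algebra ℂ A] {n : ℕ} {u : Fin n → A}
    {α : Fin n → Fin n → ℂ} (hu : ∀ i j, u i * u j = α i j • (u j * u i))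
    (r B : Fin n → Fin n → Prop) [DecidableRel r] [DecidableRel B] [Std.Total r] [IsTrans (Fin n) r]
    [Std.Antisymm r] (hB : ∀ i j, B i j → ¬ B j i) {l l' : List (Fin n)} (hl : l.Pairwise B)
    (hmem : ∀ i, i ∈ l) (hl' : l'.Pairwise r) (hperm : l'.Perm (List.finRange n)) :
    (l.map u).prod =
      (∏ i, ∏ j, if B i j ∧ ¬ r i j then α i j else 1) • (l'.map u).prod := by
  have hnd := nodup_of_pairwise_asymm hB hl
  have huniv : l.toFinset = Finset.univ := by ext; simp [hmem]
  have hll' : l.insertionSort r = l' := by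
    refine List.Perm.eq_of_pairwise (fun a b _ _ h h' => antisymm_of r h h')
      (List.pairwise_insertionSort r l) hl' ((List.perm_insertionSort r l).trans ?_)
    refine List.Perm.trans ?_ hperm.symm
    rw [List.perm_ext_iff_of_nodup hnd (List.nodup_finRange n)]
    simp [hmem]
  have hr : ∀ i, r i i := fun i => (Std.Total.total (r := r) i i).elim id id
  rw [prod_eq_phase_smul hu r, phase_eq_prod α r B hr hB l hl, huniv, hll']

theorem coe_word {n d : ℕ} (U : Fin n → Matrix.unitaryGroup (Fin d) ℂ) (l : List (Fin n)) :
    (word U l : Matrix (Fin d) (Fin d) ℂ) =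
      (l.map fun i => (U i : Matrix (Fin d) (Fin d) ℂ)).prod := by
  induction l with
  | nil => simp [word]
  | cons a l ih => simpa [word] using congrArg _ ih

theorem act_of_coe_eq_smul {d : ℕ} {V W : Matrix.unitaryGroup (Fin d) ℂ} {c : ℂ}
    (h : (V : Matrix (Fin d) (Fin d) ℂ) = c • (W : Matrix (Fin d) (Fin d) ℂ)) (v : Fin d → ℂ) :
    act V v = c • act W v := by
  rw [act, h, Matrix.smul_mulVec, act]

/-- Only the product of all phases matters, not their distribution over the targets. -/
theorem productState_smul {n d : ℕ} (χ : Fin n.factorial → ℂ) (c : Fin (numBlocks n) → ℂ)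
    (e : PhiIndex n → ℂ) (Ψ : Fin (numBlocks n) → Fin d → ℂ)
    (Φ : PhiIndex n → Fin d → ℂ) (a : Fin n → Fin d → ℂ) :
    productState χ (fun k => c k • Ψ k) (fun k => e k • Φ k) a =
      ((∏ k, c k) * ∏ k, e k) • productState χ Ψ Φ a := by
  funext p
  simp only [productState, Pi.smul_apply, smul_eq_mul, Finset.prod_mul_distrib]
  ring

/-! ### The phases of the targets -/

section Phases

open scoped Classical

variable {n : ℕ} (α : Fin n → Fin n → ℂ) (π : Perm (Fin n))

/-- The scalar between `Π_{xk}` and `Π`. -/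
def psiPhase (m k : ℕ) : ℂ :=
  ∏ i, ∏ j, if PsiBefore m π k i j ∧ ¬ i ≥ j then α i j else 1

/-- The scalar between `Π̃^r_{xk}` and `Π^r`. -/
def phiPhase (m k : ℕ) : ℂ :=
  ∏ i, ∏ j, if PhiBefore m π k i j ∧ ¬ i ≤ j then α i j else 1

/-- The scalar between `Π_x` and `Π`. -/
def permPhase : ℂ :=
  ∏ i, ∏ j, if π.symm j < π.symm i ∧ ¬ i ≥ j then α i j else 1

variable {α}

/-- There is no target `Φ_0`; this value lets products over `PhiIndex n` run over all blocks. -/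
theorem phiPhase_zero (m : ℕ) : phiPhase α π m 0 = 1 := by
  refine Finset.prod_eq_one fun i _ => Finset.prod_eq_one fun j _ => if_neg ?_
  simp only [PhiBefore, Fin.lt_def, Fin.le_def]
  omega

theorem psiPhase_mul_phiPhase (hα : ∀ i j, α i j * α j i = 1) {m : ℕ} (hm : 0 < m) (k : ℕ) :
    psiPhase α π m k * phiPhase α π m k =
      ∏ i, ∏ j, if (π.symm j : ℕ) / m = k then
        (if π.symm j < π.symm i ∧ ¬ i ≥ j then α i j else 1) else 1 := by
  have hk : k * m ≤ (k + 1) * m := Nat.mul_le_mul_right _ (Nat.le_succ _)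
  rw [psiPhase, phiPhase,
    -- Exchanging the names `i` and `j` in the second phase lets `i < j` describe the inverted pairs
    -- of both strings.
    Finset.prod_comm (f := fun i j => if PhiBefore m π k i j ∧ ¬ i ≤ j then _ else _),
    ← Finset.prod_mul_distrib]
  refine Finset.prod_congr rfl fun i _ => ?_
  rw [← Finset.prod_mul_distrib]
  refine Finset.prod_congr rfl fun j _ => ?_
  have hdiv : (π.symm j : ℕ) / m = k ↔
      k * m ≤ (π.symm j : ℕ) ∧ (π.symm j : ℕ) < (k + 1) * m := by
    rw [Nat.div_eq_iff hm, add_mul, one_mul]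
    omega
  by_cases hij : i < j
  · have h1 : PsiBefore m π k i j ∧ ¬ i ≥ j ↔
        (k * m ≤ (π.symm j : ℕ) ∧ (π.symm j : ℕ) < (k + 1) * m) ∧ π.symm j < π.symm i ∨
        (π.symm j : ℕ) < k * m ∧ k * m ≤ (π.symm i : ℕ) := by
      simp only [PsiBefore, Fin.lt_def, Fin.le_def, ge_iff_le] at hij ⊢
      omega
    have h2 : PhiBefore m π k j i ∧ ¬ j ≤ i ↔
        (π.symm j : ℕ) < k * m ∧ k * m ≤ (π.symm i : ℕ) := by
      simp only [PhiBefore, Fin.lt_def, Fin.le_def] at hij ⊢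
      omega
    simp only [h1, h2, hdiv]
    by_cases h3 : (π.symm j : ℕ) < k * m ∧ k * m ≤ (π.symm i : ℕ)
    -- Both strings invert this pair, in opposite directions, and `α i j * α j i = 1`; the
    -- right-hand side has no factor because `j` lies before block `k`.
    · have h4 : ¬ (k * m ≤ (π.symm j : ℕ) ∧ (π.symm j : ℕ) < (k + 1) * m) := by omega
      simp [h3, h4, hα]
    · have h5 : ¬ i ≥ j := not_le.2 hij
      simp only [h3, or_false, if_false, mul_one, h5, not_false_eq_true, and_true]
      rw [ite_and]
  · have h1 : ¬ (PsiBefore m π k i j ∧ ¬ i ≥ j) := fun h => hij (not_le.1 h.2)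
    have h2 : ¬ (PhiBefore m π k j i ∧ ¬ j ≤ i) := fun h => hij (not_le.1 h.2)
    have h3 : i ≥ j := not_lt.1 hij
    rw [if_neg h1, if_neg h2]
    simp [h3]

/-- Every `j` lies in exactly one block, so each inversion of `Π_x` is counted for exactly one `k`.
-/
theorem prod_psiPhase_mul_prod_phiPhase (hn : 1 ≤ n) (hα : ∀ i j, α i j * α j i = 1) :
    (∏ k : Fin (numBlocks n), psiPhase α π (blockLen n) k) *
      ∏ k : PhiIndex n, phiPhase α π (blockLen n) k.1 = permPhase α π := by
  have hm := blockLen_pos hn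
  have h1 : ∏ k : PhiIndex n, phiPhase α π (blockLen n) k.1 =
      ∏ k : Fin (numBlocks n), phiPhase α π (blockLen n) k := by
    rw [← Finset.prod_subtype (Finset.univ.filter fun k : Fin (numBlocks n) => 1 ≤ (k : ℕ))
      (by simp) fun k => phiPhase α π (blockLen n) k]
    refine Finset.prod_filter_of_ne fun k _ hk => Nat.one_le_iff_ne_zero.2 fun h => hk ?_
    rw [h, phiPhase_zero]
  rw [h1, ← Finset.prod_mul_distrib]
  simp only [psiPhase_mul_phiPhase π hα hm]
  rw [Finset.prod_comm]
  refine Finset.prod_congr rfl fun i _ => ?_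
  rw [Finset.prod_comm]
  refine Finset.prod_congr rfl fun j _ => ?_
  have hlt : (π.symm j : ℕ) / blockLen n < numBlocks n :=
    Nat.div_lt_of_lt_mul <|
      lt_of_lt_of_le (π.symm j).2 (mul_comm _ (blockLen n) ▸ le_numBlocks_mul hn)
  rw [Finset.prod_eq_single ⟨_, hlt⟩ (fun k _ hk => if_neg fun h => hk (Fin.ext h.symm)) (by simp)]
  simp

end Phases

/-! ### The strings of the targets as multiples of the sorted products -/

section

open scoped Classical

variable {n d : ℕ} {U : Fin n → Matrix.unitaryGroup (Fin d) ℂ} {α : Fin n → Fin n → ℂ}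

theorem coe_word_psiString 
    (hα : ∀ j k, (U j : Matrix (Fin d) (Fin d) ℂ) * (U k : Matrix (Fin d) (Fin d) ℂ) =
      α j k • ((U k : Matrix (Fin d) (Fin d) ℂ) * (U j : Matrix (Fin d) (Fin d) ℂ)))
    (m : ℕ) (π : Perm (Fin n)) (k : ℕ) :
    (word U (psiString m π k) : Matrix (Fin d) (Fin d) ℂ) =
      psiPhase α π m k • (descProd U : Matrix (Fin d) (Fin d) ℂ) := by
  rw [descProd, coe_word, coe_word, psiPhase]
  exact prod_eq_smul_of_pairwise hα (fun i j => i ≥ j) _ (fun _ _ => PsiBefore.asymm)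
    (pairwise_psiString m π k) (mem_psiString m π k)
    (List.pairwise_reverse.2 ((List.pairwise_lt_finRange n).imp le_of_lt)) (List.reverse_perm _)

theorem coe_word_phiString 
    (hα : ∀ j k, (U j : Matrix (Fin d) (Fin d) ℂ) * (U k : Matrix (Fin d) (Fin d) ℂ) =
      α j k • ((U k : Matrix (Fin d) (Fin d) ℂ) * (U j : Matrix (Fin d) (Fin d) ℂ)))
    (m : ℕ) (π : Perm (Fin n)) (k : ℕ) :
    (word U (phiString m π k) : Matrix (Fin d) (Fin d) ℂ) =
      phiPhase α π m k • (ascProd U : Matrix (Fin d) (Fin d) ℂ) := by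
  rw [ascProd, coe_word, coe_word, phiPhase]
  exact prod_eq_smul_of_pairwise hα (fun i j => i ≤ j) _ (fun _ _ => PhiBefore.asymm)
    (pairwise_phiString m π k) (mem_phiString m π k)
    ((List.pairwise_lt_finRange n).imp le_of_lt) (List.Perm.refl _)

theorem coe_permProd 
    (hα : ∀ j k, (U j : Matrix (Fin d) (Fin d) ℂ) * (U k : Matrix (Fin d) (Fin d) ℂ) =
      α j k • ((U k : Matrix (Fin d) (Fin d) ℂ) * (U j : Matrix (Fin d) (Fin d) ℂ)))
    (π : Perm (Fin n)) :
    (permProd U π : Matrix (Fin d) (Fin d) ℂ) =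
      permPhase α π • (descProd U : Matrix (Fin d) (Fin d) ℂ) := by
  rw [permProd, descProd, coe_word, coe_word, permPhase]
  refine prod_eq_smul_of_pairwise hα (fun i j => i ≥ j) (fun i j => π.symm j < π.symm i)
    (fun _ _ h => h.asymm) ?_ ?_
    (List.pairwise_reverse.2 ((List.pairwise_lt_finRange n).imp le_of_lt)) (List.reverse_perm _)
  · rw [permString, List.pairwise_reverse, List.pairwise_ofFn]
    intro i j hij
    simpa using hij
  · intro i
    rw [permString, List.mem_reverse, List.mem_ofFn]
    exact π.surjective i

end

theorem State.subsingleton {n : ℕ} (hn : 1 ≤ n) : Subsingleton (State n 0) :=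
  ⟨fun _ _ => funext fun p => (p.2 (aux ⟨0, hn⟩)).elim0⟩

theorem productState_of_pairwiseCommutation {n d : ℕ} (hn : 1 ≤ n)
    {U : Fin n → Matrix.unitaryGroup (Fin d) ℂ} (hU : PairwiseCommutation U)
    (π : Perm (Fin n)) (χ : Fin n.factorial → ℂ) (Ψ : Fin (numBlocks n) → Fin d → ℂ)
    (Φ : PhiIndex n → Fin d → ℂ) (a : Fin n → Fin d → ℂ) :
    productState χ (fun k => act (word U (psiString (blockLen n) π k)) (Ψ k))
        (fun k => act (word U (phiString (blockLen n) π k.1)) (Φ k)) a =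
      productState χ (psiFinal U (permProd U π) Ψ) (phiFinal U Φ) a := by
  -- In dimension `0` all matrices vanish and do not constrain `α`, but then all states coincide.
  rcases d with _ | d
  · exact (State.subsingleton hn).elim _ _
  choose α hα using hU
  have hαα : ∀ i j, α i j * α j i = 1 := by
    intro i j
    have h := hα i j
    rw [hα j i, smul_smul] at h
    -- Commuting twice returns the same product, so `α i j * α j i = 1` once that product is
    -- nonzero.
    have h0 : ((U i * U j : Matrix.unitaryGroup (Fin (d + 1)) ℂ) :
        Matrix (Fin (d + 1)) (Fin (d + 1)) ℂ) ≠ 0 := by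
      intro h0
      have h1 := Matrix.UnitaryGroup.star_mul_self (U i * U j)
      rw [h0, mul_zero] at h1
      exact zero_ne_one h1
    have h2 : (1 - α i j * α j i) • ((U i * U j : Matrix.unitaryGroup (Fin (d + 1)) ℂ) :
        Matrix (Fin (d + 1)) (Fin (d + 1)) ℂ) = 0 := by
      rw [sub_smul, one_smul, sub_eq_zero]
      exact h
    rw [smul_eq_zero, or_iff_left h0, sub_eq_zero] at h2
    exact h2.symm
  have hpsi : psiFinal U (permProd U π) Ψ =
      fun k : Fin (numBlocks n) =>
        (if (k : ℕ) = 0 then permPhase α π else 1) • act (descProd U) (Ψ k) := by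
    funext k
    rw [psiFinal]
    split_ifs
    · exact act_of_coe_eq_smul (coe_permProd hα π) _
    · rw [one_smul]
  have hphi : phiFinal U Φ = fun k => (1 : ℂ) • act (ascProd U) (Φ k) := by
    funext k
    rw [one_smul, phiFinal]
  rw [hpsi, hphi]
  simp only [act_of_coe_eq_smul (coe_word_psiString hα _ _ _),
    act_of_coe_eq_smul (coe_word_phiString hα _ _ _)]
  rw [productState_smul, productState_smul, prod_psiPhase_mul_prod_phiPhase π hn hαα,
    Finset.prod_const_one, mul_one, Finset.prod_eq_single ⟨0, numBlocks_pos hn⟩]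
  · simp
  · intro k _ hk
    exact if_neg fun h => hk (Fin.ext h)
  · simp

/-! ### The promise implies pairwise commutation relations -/

theorem exists_permString_eq {n : ℕ} {l : List (Fin n)} (hl : l.Nodup) (hmem : ∀ i, i ∈ l) :
    ∃ π : Perm (Fin n), permString π = l := by
  have hlen : l.reverse.length = n := by
    have h : l.Perm (List.finRange n) := by
      rw [List.perm_ext_iff_of_nodup hl (List.nodup_finRange n)]
      simp [hmem]
    rw [List.length_reverse, h.length_eq, List.length_finRange]
  refine ⟨(finCongr hlen.symm).trans (List.Nodup.getEquivOfForallMemList l.reverse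
    (List.nodup_reverse.2 hl) (by simpa using hmem)), ?_⟩
  rw [permString, List.reverse_eq_iff]
  refine List.ext_get (by simpa using hlen.symm) fun i h1 h2 => ?_
  simp

/-- A labeling reaches all permutations, in particular two whose strings `j k W` and `k j W` differ
only in the two leftmost letters. Both products are multiples of `Π_0` by powers of `ω`, and the
unitary word of `W` cancels. -/
theorem Promise.pairwiseCommutation {n d : ℕ} {σ : Labeling n}
    {U : Fin n → Matrix.unitaryGroup (Fin d) ℂ} {y : Fin n.factorial} (h : Promise σ U y) :
    PairwiseCommutation U := by
  intro j k
  by_cases hjk : j = k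
  · exact ⟨1, by rw [hjk, one_smul]⟩
  set W := ((List.finRange n).erase j).erase k with hW
  have hnd : ((List.finRange n).erase j).Nodup := (List.nodup_finRange n).erase j
  have hWnd : W.Nodup := hnd.erase k
  have hmem : ∀ i, i ∈ W ↔ i ≠ k ∧ i ≠ j := fun i => by
    rw [hW, hnd.mem_erase_iff, (List.nodup_finRange n).mem_erase_iff]
    simp
  obtain ⟨π, hπ⟩ := exists_permString_eq (l := j :: k :: W) (by simp [hmem, hWnd, hjk])
    (fun i => by simp only [List.mem_cons, hmem]; tauto)
  obtain ⟨ρ, hρ⟩ := exists_permString_eq (l := k :: j :: W) (by simp [hmem, hWnd, Ne.symm hjk])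
    (fun i => by simp only [List.mem_cons, hmem]; tauto)
  have h1 := h (σ.symm π)
  have h2 := h (σ.symm ρ)
  rw [σ.apply_symm_apply, permProd] at h1 h2
  rw [hπ] at h1
  rw [hρ] at h2
  set ζ := omega n.factorial
  have hζ : ζ ≠ 0 := Complex.exp_ne_zero _
  set r := ((σ.symm ρ : Fin n.factorial) : ℕ) * (y : ℕ)
  set s := ((σ.symm π : Fin n.factorial) : ℕ) * (y : ℕ)
  refine ⟨ζ ^ s * (ζ ^ r)⁻¹, ?_⟩
  have h3 : (word U (j :: k :: W) : Matrix (Fin d) (Fin d) ℂ) =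
      (ζ ^ s * (ζ ^ r)⁻¹) • (word U (k :: j :: W) : Matrix (Fin d) (Fin d) ℂ) := by
    rw [h1, h2, smul_smul, mul_assoc, inv_mul_cancel₀ (pow_ne_zero _ hζ), mul_one]
  have h4 : ∀ a b, (word U (a :: b :: W) : Matrix (Fin d) (Fin d) ℂ) =
      (U a : Matrix (Fin d) (Fin d) ℂ) * (U b : Matrix (Fin d) (Fin d) ℂ) *
        (word U W : Matrix (Fin d) (Fin d) ℂ) := fun a b => by
    simp [coe_word, mul_assoc]
  have h5 : (word U W : Matrix (Fin d) (Fin d) ℂ) * star (word U W : Matrix (Fin d) (Fin d) ℂ) = 1 :=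
    Matrix.mem_unitaryGroup_iff.1 (word U W).2
  rw [h4, h4, ← smul_mul_assoc] at h3
  have h6 := congrArg (· * star (word U W : Matrix (Fin d) (Fin d) ℂ)) h3
  simpa only [mul_assoc _ (word U W : Matrix (Fin d) (Fin d) ℂ), h5, mul_one] using h6

/-! ### The Fourier transform of the control system -/

theorem onControl_productState {n d : ℕ} (V : Matrix.unitaryGroup (Fin n.factorial) ℂ)
    (χ : Fin n.factorial → ℂ) (Ψ : Fin (numBlocks n) → Fin d → ℂ)
    (Φ : PhiIndex n → Fin d → ℂ) (a : Fin n → Fin d → ℂ) :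
    onControl V (productState χ Ψ Φ a) = productState (act V χ) Ψ Φ a := by
  funext p
  simp only [onControl, productState, act, Matrix.mulVec, dotProduct, LinearMap.coe_mk,
    AddHom.coe_mk, Finset.sum_mul, mul_assoc]

theorem productState_eq_sum {n d : ℕ} (χ : Fin n.factorial → ℂ)
    (Ψ : Fin (numBlocks n) → Fin d → ℂ) (Φ : PhiIndex n → Fin d → ℂ) (a : Fin n → Fin d → ℂ) :
    productState χ Ψ Φ a = ∑ x, χ x • productState (ket x) Ψ Φ a := by
  funext p
  rw [Finset.sum_apply, Finset.sum_eq_single p.1]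
  · simp [productState, ket]
  · intro x _ hx
    simp [productState, ket, hx.symm]
  · simp

theorem act_ket {n : ℕ} (V : Matrix.unitaryGroup (Fin n.factorial) ℂ) (y x : Fin n.factorial) :
    act V (ket y) x = (V : Matrix (Fin n.factorial) (Fin n.factorial) ℂ) x y := by
  simp [act, ket]

theorem psiFinal_smul {n d : ℕ} (hn : 1 ≤ n) (U : Fin n → Matrix.unitaryGroup (Fin d) ℂ)
    {V W : Matrix.unitaryGroup (Fin d) ℂ} {c : ℂ}
    (h : (V : Matrix (Fin d) (Fin d) ℂ) = c • (W : Matrix (Fin d) (Fin d) ℂ))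
    (χ : Fin n.factorial → ℂ) (Ψ : Fin (numBlocks n) → Fin d → ℂ)
    (Φ : PhiIndex n → Fin d → ℂ) (a : Fin n → Fin d → ℂ) :
    productState χ (psiFinal U V Ψ) Φ a = c • productState χ (psiFinal U W Ψ) Φ a := by
  have h1 : psiFinal U V Ψ = fun k : Fin (numBlocks n) =>
      (if (k : ℕ) = 0 then c else 1) • psiFinal U W Ψ k := by
    funext k
    simp only [psiFinal]
    split_ifs
    · exact act_of_coe_eq_smul h _
    · rw [one_smul]
  have h2 := productState_smul χ (fun k => if (k : ℕ) = 0 then c else 1) (fun _ => 1)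
    (psiFinal U W Ψ) Φ a
  simp only [one_smul] at h2
  rw [h1, h2, Finset.prod_const_one, mul_one, Finset.prod_eq_single ⟨0, numBlocks_pos hn⟩]
  · simp
  · intro k _ hk
    exact if_neg fun h => hk (Fin.ext h)
  · simp

/-- Phase kickback: by linearity each branch `x` of the uniform superposition acquires `ω^{xy}`,
while the remaining systems reach a state independent of `x`. -/
theorem run_fourierSandwich {n d : ℕ} (hn : 1 ≤ n) {σ : Labeling n}
    {U : Fin n → Matrix.unitaryGroup (Fin d) ℂ} {y : Fin n.factorial} (hU : Promise σ U y)
    {T : Circuit n} {Ψ : Fin (numBlocks n) → Fin d → ℂ} {Φ Φ' : PhiIndex n → Fin d → ℂ}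
    {a a' : Fin n → Fin d → ℂ}
    (hT : ∀ x, run σ U T (productState (ket x) Ψ Φ a) =
      productState (ket x) (psiFinal U (permProd U (σ x)) Ψ) Φ' a') :
    run σ U (fourierSandwich T) (productState (ket (label0 n)) Ψ Φ a) =
      productState (ket y) (psiFinal U (permProd U (σ (label0 n))) Ψ) Φ' a' := by
  have h1 : ∀ ψ : State n d, run σ U (fourierSandwich T) ψ =
      onControl (fourier n.factorial)⁻¹ (run σ U T (onControl (fourier n.factorial) ψ)) :=
    fun ψ => by
      change run σ U (T ++ [Gate.fourierInv]) (onControl _ ψ) = _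
      rw [run_append]
      rfl
  -- Column `0` of the Fourier matrix is constant, so multiplication by `ω^{xy}` produces column
  -- `y`.
  have h2 : ∀ x, act (fourier n.factorial) (ket (label0 n)) x *
      omega n.factorial ^ ((x : ℕ) * (y : ℕ)) = act (fourier n.factorial) (ket y) x := by
    intro x
    simp [act_ket, fourier, fourierMatrix, label0]
  have h3 : run σ U T (productState (act (fourier n.factorial) (ket (label0 n))) Ψ Φ a) =
      productState (act (fourier n.factorial) (ket y))
        (psiFinal U (permProd U (σ (label0 n))) Ψ) Φ' a' := by
    rw [productState_eq_sum, productState_eq_sum (act _ (ket y)), map_sum]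
    refine Finset.sum_congr rfl fun x _ => ?_
    rw [map_smul, hT, psiFinal_smul hn U (hU x), smul_smul, h2]
  rw [h1, onControl_productState, h3, onControl_productState, ← act_mul, inv_mul_cancel, act_one]

/-! ### Measurement of the control system -/

theorem Normalized.act {d : ℕ} {v : Fin d → ℂ} (hv : Normalized v)
    (V : Matrix.unitaryGroup (Fin d) ℂ) : Normalized (act V v) := by
  have h : ∀ w : Fin d → ℂ, ((∑ j, ‖w j‖ ^ 2 : ℝ) : ℂ) = star w ⬝ᵥ w := by
    intro w
    simp only [dotProduct, Pi.star_apply, Complex.ofReal_sum, Complex.ofReal_pow]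
    exact Finset.sum_congr rfl fun j _ => (Complex.conj_mul' _).symm
  rw [Normalized, ← Complex.ofReal_inj, h] at hv ⊢
  rw [FPP.act, Matrix.star_mulVec, ← Matrix.dotProduct_mulVec, Matrix.mulVec_mulVec,
    ← Matrix.star_eq_conjTranspose, Matrix.UnitaryGroup.star_mul_self, Matrix.one_mulVec, hv]

theorem controlProb_productState {n d : ℕ} (y : Fin n.factorial)
    {Ψ : Fin (numBlocks n) → Fin d → ℂ} {Φ : PhiIndex n → Fin d → ℂ} {a : Fin n → Fin d → ℂ}
    (hΨ : ∀ k, Normalized (Ψ k)) (hΦ : ∀ k, Normalized (Φ k)) (ha : ∀ i, Normalized (a i)) :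
    controlProb (productState (ket y) Ψ Φ a) y = 1 := by
  have hw : ∀ w, ∑ j, ‖wires Ψ Φ a w j‖ ^ 2 = 1 := by
    rintro (k | k | i)
    exacts [hΨ k, hΦ k, ha i]
  have h : ∀ b : Wire n → Fin d, ‖prodState (ket y) (wires Ψ Φ a) (y, b)‖ ^ 2 =
      ∏ w, ‖wires Ψ Φ a w (b w)‖ ^ 2 := by
    intro b
    simp [prodState, ket, Finset.prod_pow]
  rw [productState_eq, controlProb, Finset.sum_congr rfl fun b _ => h b]
  -- The squared norm of a product state factors over the systems.
  rw [← Fintype.prod_sum (fun w j => ‖wires Ψ Φ a w j‖ ^ 2)]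
  exact Finset.prod_eq_one fun w _ => hw w

/-! ### The circuit -/

theorem run_program {n d : ℕ} (hn : 1 ≤ n) (σ : Labeling n)
    (U : Fin n → Matrix.unitaryGroup (Fin d) ℂ) (Ψ : Fin (numBlocks n) → Fin d → ℂ)
    (Φ : PhiIndex n → Fin d → ℂ) (a : Fin n → Fin d → ℂ) (x : Fin n.factorial) :
    run σ U (compile (program n)) (productState (ket x) Ψ Φ a) =
      productState (ket x)
        (fun k => act (word U (psiString (blockLen n) (σ x) k)) (Ψ k))
        (fun k => act (word U (phiString (blockLen n) (σ x) k.1)) (Φ k))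
        (auxFinal U a) := by
  rw [productState_eq, run_compile, productState_eq]
  congr 1
  funext w
  rcases w with k | k | i
  · rw [trace_psi hn, List.reverse_reverse]
    rfl
  · rw [trace_phi, List.reverse_reverse]
    rfl
  · rw [trace_aux hn, List.reverse_replicate, word, List.map_replicate, List.prod_replicate]
    rfl

theorem queriesTo_program {n : ℕ} (hn : 1 ≤ n) (i : Fin n) :
    (queriesTo i (compile (program n)) : ℤ) = (blockLen n : ℤ) + 4 * (numBlocks n : ℤ) - 4 := by
  -- At least one block makes the truncated `numBlocks n - 1` agree with the integer difference.
  have := numBlocks_pos hn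
  rw [queriesTo_compile, count_map_fst_program, phiIndices, Finset.length_toList,
    Finset.card_univ, card_phiIndex]
  omega

theorem queries_fourierSandwich {n : ℕ} {T : Circuit n} {q : ℤ}
    (h : ∀ i, (queriesTo i T : ℤ) = q) : (queries (fourierSandwich T) : ℤ) = q * n := by
  have h1 : ∀ i, queriesTo i (fourierSandwich T) = queriesTo i T := fun i => by
    simp [fourierSandwich, queriesTo, gateQueriesTo]
  simp [queries, h1, h, mul_comm]

end FPP

end

theorem mainTheorem1 (n : ℕ) (hn : 1 ≤ n) :
    ∃ T : FPP.Circuit n,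
      -- the circuit consists of controlled swaps and queries, and its query count
      FPP.FourierFree T ∧
      (∀ i : Fin n, (FPP.queriesTo i T : ℤ) =
        (FPP.blockLen n : ℤ) + 4 * (FPP.numBlocks n : ℤ) - 4) ∧
      (FPP.queries (FPP.fourierSandwich T) : ℤ) =
        ((FPP.blockLen n : ℤ) + 4 * (FPP.numBlocks n : ℤ) - 4) * (n : ℤ) ∧
      (FPP.queries (FPP.fourierSandwich T) : ℝ) < (5 * Real.sqrt (n : ℝ) + 1) * (n : ℝ) ∧
      ∀ σ : FPP.Labeling n,
        -- every Fourier promise problem is solved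
        FPP.Solves (FPP.fourierSandwich T) σ ∧
        ∀ (d : ℕ) (U : Fin n → Matrix.unitaryGroup (Fin d) ℂ)
          (Ψ : Fin (FPP.numBlocks n) → Fin d → ℂ) (Φ : FPP.PhiIndex n → Fin d → ℂ)
          (a : Fin n → Fin d → ℂ),
          -- the transformation, for arbitrary unitaries
          (∀ x : Fin n.factorial,
            FPP.run σ U T (FPP.productState (FPP.ket x) Ψ Φ a) =
              FPP.productState (FPP.ket x)
                (fun k => FPP.act (FPP.word U (FPP.psiString (FPP.blockLen n) (σ x) k)) (Ψ k))
                (fun k => FPP.act (FPP.word U (FPP.phiString (FPP.blockLen n) (σ x) k.1)) (Φ k))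
                (FPP.auxFinal U a)) ∧
          -- the transformation, for unitaries with pairwise commutation relations
          (FPP.PairwiseCommutation U → ∀ x : Fin n.factorial,
            FPP.run σ U T (FPP.productState (FPP.ket x) Ψ Φ a) =
              FPP.productState (FPP.ket x)
                (FPP.psiFinal U (FPP.permProd U (σ x)) Ψ) (FPP.phiFinal U Φ)
                (FPP.auxFinal U a)) ∧
          -- the transformation and the final state of the algorithm, under the promise
          (∀ y : Fin n.factorial, FPP.Promise σ U y →
            (∀ x : Fin n.factorial,
              FPP.run σ U T (FPP.productState (FPP.ket x) Ψ Φ a) =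
                FPP.productState (FPP.ket x)
                  (FPP.psiFinal U (FPP.permProd U (σ x)) Ψ) (FPP.phiFinal U Φ)
                  (FPP.auxFinal U a)) ∧
            FPP.run σ U (FPP.fourierSandwich T)
                (FPP.productState (FPP.ket (FPP.label0 n)) Ψ Φ a) =
              FPP.productState (FPP.ket y)
                (FPP.psiFinal U (FPP.permProd U (σ (FPP.label0 n))) Ψ) (FPP.phiFinal U Φ)
                (FPP.auxFinal U a)) := by
  have hq := FPP.queries_fourierSandwich fun i => FPP.queriesTo_program hn i
  refine ⟨FPP.compile (FPP.program n), FPP.fourierFree_compile _, FPP.queriesTo_program hn, hq,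
    ?_, fun σ => ?_⟩
  · have hn0 : (0 : ℝ) < n := by exact_mod_cast hn
    have hq' : (FPP.queries (FPP.fourierSandwich (FPP.compile (FPP.program n))) : ℝ) =
        ((FPP.blockLen n : ℝ) + 4 * FPP.numBlocks n - 4) * n := by exact_mod_cast hq
    rw [hq']
    exact mul_lt_mul_of_pos_right (FPP.blockLen_add_numBlocks_lt hn) hn0
  have hcomm : ∀ (d : ℕ) (U : Fin n → Matrix.unitaryGroup (Fin d) ℂ) Ψ Φ a,
      FPP.PairwiseCommutation U → ∀ x : Fin n.factorial,
        FPP.run σ U (FPP.compile (FPP.program n)) (FPP.productState (FPP.ket x) Ψ Φ a) =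
          FPP.productState (FPP.ket x) (FPP.psiFinal U (FPP.permProd U (σ x)) Ψ)
            (FPP.phiFinal U Φ) (FPP.auxFinal U a) := fun d U Ψ Φ a hU x => by
    rw [FPP.run_program hn, FPP.productState_of_pairwiseCommutation hn hU]
  refine ⟨fun d U y hU Ψ Φ a hΨ hΦ ha => ?_, fun d U Ψ Φ a => ⟨FPP.run_program hn σ U Ψ Φ a,
    hcomm d U Ψ Φ a, fun y hU => ⟨hcomm d U Ψ Φ a hU.pairwiseCommutation,
      FPP.run_fourierSandwich hn hU (hcomm d U Ψ Φ a hU.pairwiseCommutation)⟩⟩⟩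
  rw [FPP.run_fourierSandwich hn hU (hcomm d U Ψ Φ a hU.pairwiseCommutation)]
  refine FPP.controlProb_productState y (fun k => ?_) (fun k => (hΦ k).act _)
    (fun i => (ha i).act _)
  rw [FPP.psiFinal]
  split_ifs
  exacts [(hΨ k).act _, (hΨ k).act _]
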